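/- **Setting.** Let $J:\mathbb R^M\to\mathbb R$ be twice differentiable with $0<\nu I\le\nabla^2J(w)\le\delta I$ for all $w$ (so $\nu\le\delta$), let $w^o$ be its minimizer, and $H=\nabla^2J(w^o)$. Consider the asynchronous stochastic-gradient algorithm $$\boldsymbol w_i=\boldsymbol w_{i-1}-\boldsymbol\mu(i)\,\widehat{\nabla J}_i(\boldsymbol w_{i-1}),\qquad i\ge 0,$$ with $\mathbb E\|\boldsymbol w_{-1}\|^2<\infty$. Put $\widetilde{\boldsymbol w}_i=w^o-\boldsymbol w_i$, $\boldsymbol s_i(w)=\widehat{\nabla J}_i(w)-\nabla J(w)$, $\mathcal F_{i-1}=\sigma(\boldsymbol w_{-1},\dots,\boldsymbol w_{i-1})$ and $R_{s,i}(w)=\mathbb E[\boldsymbol s_i(w)\boldsymbol s_i(w)^{\mathsf T}\mid\mathcal F_{i-1}]$. Assume: * (gradient noise) almost surely, $\mathbb E[\boldsymbol s_i(\boldsymbol w_{i-1})\mid\mathcal F_{i-1}]=0$, $\mathbb E[\|\boldsymbol s_i(\boldsymbol w_{i-1})\|^2\mid\mathcal F_{i-1}]\le\beta^2\|\widetilde{\boldsymbol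 w}_{i-1}\|^2+\sigma_s^2$, and $R_{s,i}(w^o)\to R_s$ as $i\to\infty$, where $R_s$ is a constant matrix; * (step-sizes) the $\boldsymbol\mu(i)$ are independent, take values in $[0,\mu_{\rm ub}]$, have mean $\bar\mu>0$ and variance $\sigma_\mu^2$ for every $i$, and each $\boldsymbol\mu(i)$ is independent of the iterates $\boldsymbol w_j$, $j\le i-1$, and of the approximate gradients $\widehat{\nabla J}_j(\boldsymbol w_{j-1})$, $j\le i$; * (smoothness) for some $r>0$, $\tau,\tau_2\ge0$, $1\le\kappa\le2$ and all $\|\delta w\|\le r$: $\|\nabla^2J(w^o+\delta w)-H\|\le\tau\|\delta w\|$ and $\|R_{s,i}(w^o+\delta w)-R_{s,i}(w^o)\|\le\tau_2\|\delta w\|^\kappa$ almost surely, the latter also for $\mathcal F_{i-1}$-measurable $\delta w$ (wherever $R_{s,i}(w^o+\delta w)$ is defined). Let $\mu_x=\bar\mu+\sigma_\mu^2/\bar\mu$ and $\mu_o=2\nu/(\delta^2+\beta^2)$. **Convergence rate.** If $\mu_x<\mu_o$, then for all $i\ge0$ $$\mathbb E\|\widetilde{\boldsymbol w}_i\|^2\le\alpha\,\mathbb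 E\|\widetilde{\boldsymbol w}_{i-1}\|^2+(\bar\mu^2+\sigma_\mu^2)\sigma_s^2,$$ with all these expectations finite, where $\alpha=1-2\nu\bar\mu+(\delta^2+\beta^2)(\bar\mu^2+\sigma_\mu^2)$ satisfies $0\le\alpha<1$ and $$\alpha=1-2\nu\bar\mu+O(\mu_x^2).$$ **Performance.** Assume in addition that either $\nabla^2J$ is constant, or the following fourth-order moment conditions hold for some constants $\beta_4,\sigma_4,\rho$ and all $i$: $\mathbb E[\|\boldsymbol s_i(\boldsymbol w_{i-1})\|^4\mid\mathcal F_{i-1}]\le\beta_4^4\|\widetilde{\boldsymbol w}_{i-1}\|^4+\sigma_4^4$ almost surely and $\mathbb E\,\boldsymbol\mu(i)^4\le\rho\,\bar\mu\,\mu_x^2$ (the latter holds whenever $\mu_{\rm ub}^2\le\rho\,\mu_x$). Then, for all sufficiently small $\mu_x$, $$\mathrm{MSD}=\frac{\mu_x}{2}\,\mathrm{Tr}(H^{-1}R_s)+O(\mu_x^{3/2}),\qquad \mathrm{ER}=\frac{\mu_x}{4}\,\mathrm{Tr}(R_s)+O(\mu_x^{3/2}),$$ where MSD stands for both $\limsup_{i\to\infty}$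 and $\liminf_{i\to\infty}$ of $\mathbb E\|\widetilde{\boldsymbol w}_i\|^2$, and ER for both $\limsup$ and $\liminf$ of $\mathbb E\{J(\boldsymbol w_{i-1})-J(w^o)\}$ (hence for the limits when these exist). The constants in the $O(\cdot)$ terms and the threshold on $\mu_x$ depend only on $J$, $w^o$, $\nu,\delta,\beta,\sigma_s,\tau,\tau_2,\kappa,r,\beta_4,\sigma_4,\rho$ and $R_s$; they do not depend on the step-size process, the initial condition, or the probability space. -/

import Mathlib

open MeasureTheory ProbabilityTheory Filter Topology
open scoped ENNReal

noncomputable section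

/-- The Hessian matrix of `J` at `w`: the Jacobian matrix of the gradient of `J`. -/
def hessianMatrix {M : ℕ} (J : EuclideanSpace ℝ (Fin M) → ℝ) (w : EuclideanSpace ℝ (Fin M)) :
    Matrix (Fin M) (Fin M) ℝ :=
  Matrix.of fun m n => (fderiv ℝ (gradient J) w (EuclideanSpace.single n 1)) m

/-- `J` is twice differentiable with `0 < ν I ≤ ∇² J(w) ≤ δ I` for all `w`, and `wo` is its
global minimizer. -/
structure CostConditions {M : ℕ} (J : EuclideanSpace ℝ (Fin M) → ℝ)
    (wo : EuclideanSpace ℝ (Fin M)) (ν δ : ℝ) : Prop where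
  differentiable : Differentiable ℝ J
  differentiable_gradient : Differentiable ℝ (gradient J)
  pos : 0 < ν
  le : ν ≤ δ
  lower : ∀ w, (hessianMatrix J w - ν • (1 : Matrix (Fin M) (Fin M) ℝ)).PosSemidef
  upper : ∀ w, (δ • (1 : Matrix (Fin M) (Fin M) ℝ) - hessianMatrix J w).PosSemidef
  minimizer : ∀ w, J wo ≤ J w

/-- The data of an asynchronous stochastic-gradient algorithm on `ℝ^M`: a random initial point,
random step-sizes `step i` and random approximate gradient maps `ghat i`, for `i = 0, 1, 2, …`. -/
structure AsyncSGD (Ω : Type*) [MeasurableSpace Ω] (M : ℕ) where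
  init : Ω → EuclideanSpace ℝ (Fin M)
  step : ℕ → Ω → ℝ
  ghat : ℕ → EuclideanSpace ℝ (Fin M) → Ω → EuclideanSpace ℝ (Fin M)
  measurable_init : Measurable init
  measurable_step : ∀ i, Measurable (step i)
  measurable_ghat : ∀ i, Measurable fun p : EuclideanSpace ℝ (Fin M) × Ω => ghat i p.1 p.2

namespace AsyncSGD

variable {Ω : Type*} [MeasurableSpace Ω] {M : ℕ}

/-- The iterates, with the index shifted by one: `A.iter i` is the point `w_{i-1}` at which the
`i`-th approximate gradient is evaluated, so that
`w_i = w_{i-1} - μ(i) • ghat_i (w_{i-1})` for `i ≥ 0`. -/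
def iter (A : AsyncSGD Ω M) : ℕ → Ω → EuclideanSpace ℝ (Fin M)
  | 0 => A.init
  | i + 1 => fun ω => iter A i ω - A.step i ω • A.ghat i (iter A i ω) ω

/-- The error vector `wo - w_{i-1}`. -/
def err (A : AsyncSGD Ω M) (wo : EuclideanSpace ℝ (Fin M)) (i : ℕ) (ω : Ω) :
    EuclideanSpace ℝ (Fin M) :=
  wo - A.iter i ω

/-- The σ-algebra `F_{i-1}` generated by `w_{-1}, w_0, …, w_{i-1}`. -/
abbrev past (A : AsyncSGD Ω M) (i : ℕ) : MeasurableSpace Ω :=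
  ⨆ j : Fin (i + 1), MeasurableSpace.comap (A.iter j) inferInstance

/-- The gradient noise `s_i(w)`, a random field in `w`. -/
def noise (A : AsyncSGD Ω M) (J : EuclideanSpace ℝ (Fin M) → ℝ) (i : ℕ)
    (w : EuclideanSpace ℝ (Fin M)) (ω : Ω) : EuclideanSpace ℝ (Fin M) :=
  A.ghat i w ω - gradient J w

/-- The conditional second-order moment `R_{s,i}(W) = E[s_i(W) s_i(W)ᵀ | F_{i-1}]` of the gradient
noise at a (possibly random) point `W`. -/
def condCov (A : AsyncSGD Ω M) (P : Measure Ω) (J : EuclideanSpace ℝ (Fin M) → ℝ) (i : ℕ)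
    (W : Ω → EuclideanSpace ℝ (Fin M)) (ω : Ω) : Matrix (Fin M) (Fin M) ℝ :=
  Matrix.of fun m n =>
    (P[fun ω' => A.noise J i (W ω') ω' m * A.noise J i (W ω') ω' n | A.past i]) ω

/-- Conditions on the gradient noise: conditionally on the past it has zero mean at the iterate,
second moment at most `β² ‖err‖² + σs²`, and its conditional covariance matrix at `wo` tends almost
surely to the constant matrix `Rs`. The conditional second moment is the `[0, ∞]`-valued one, so
that the bound includes the finiteness of the moment. -/
structure NoiseConditions (A : AsyncSGD Ω M) (P : Measure Ω)
    (J : EuclideanSpace ℝ (Fin M) → ℝ) (wo : EuclideanSpace ℝ (Fin M)) (β σs : ℝ)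
    (Rs : Matrix (Fin M) (Fin M) ℝ) : Prop where
  mean_zero : ∀ i, P[fun ω => A.noise J i (A.iter i ω) ω | A.past i] =ᵐ[P] 0
  second_moment : ∀ i, ∀ᵐ ω ∂P,
    condLExp (A.past i) P (fun ω' => ‖A.noise J i (A.iter i ω') ω'‖ₑ ^ 2) ω
      ≤ ENNReal.ofReal (β ^ 2 * ‖A.err wo i ω‖ ^ 2 + σs ^ 2)
  memLp_minimizer : ∀ i, MemLp (A.noise J i wo) 2 P
  tendsto_cov : ∀ᵐ ω ∂P, Tendsto (fun i => A.condCov P J i (fun _ => wo) ω) atTop (𝓝 Rs)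

/-- Conditions on the step-size process: independent random variables with values in `[0, μub]`,
with mean `μbar > 0` and variance `σμ²` that do not depend on `i`; and each `step i` is
independent of the iterates and of the approximate gradients that the algorithm has used up to (and
including) the `i`-th update. -/
structure StepConditions (A : AsyncSGD Ω M) (P : Measure Ω) (μub μbar σμ : ℝ) : Prop where
  ub_pos : 0 < μub
  mem_Icc : ∀ i, ∀ᵐ ω ∂P, A.step i ω ∈ Set.Icc 0 μub
  iIndep : iIndepFun A.step P
  mean_pos : 0 < μbar
  mean : ∀ i, ∫ ω, A.step i ω ∂P = μbar
  variance : ∀ i, ∫ ω, (A.step i ω - μbar) ^ 2 ∂P = σμ ^ 2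
  indep : ∀ i, Indep (MeasurableSpace.comap (A.step i) inferInstance)
    (A.past i ⊔ ⨆ j : Fin (i + 1),
      MeasurableSpace.comap (fun ω => A.ghat j (A.iter j ω) ω) inferInstance) P

/-- The asymptotic mean-square deviation, `limsup E ‖err‖²`. -/
def msdSup (A : AsyncSGD Ω M) (P : Measure Ω) (wo : EuclideanSpace ℝ (Fin M)) : ℝ :=
  limsup (fun i => ∫ ω, ‖A.err wo i ω‖ ^ 2 ∂P) atTop

/-- The corresponding lower limit; the limit exists exactly when the two agree. -/
def msdInf (A : AsyncSGD Ω M) (P : Measure Ω) (wo : EuclideanSpace ℝ (Fin M)) : ℝ :=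
  liminf (fun i => ∫ ω, ‖A.err wo i ω‖ ^ 2 ∂P) atTop

/-- The asymptotic excess risk, `limsup E {J(w_{i-1}) - J(wo)}`. -/
def erSup (A : AsyncSGD Ω M) (P : Measure Ω) (J : EuclideanSpace ℝ (Fin M) → ℝ)
    (wo : EuclideanSpace ℝ (Fin M)) : ℝ :=
  limsup (fun i => ∫ ω, (J (A.iter i ω) - J wo) ∂P) atTop

/-- The corresponding lower limit. -/
def erInf (A : AsyncSGD Ω M) (P : Measure Ω) (J : EuclideanSpace ℝ (Fin M) → ℝ)
    (wo : EuclideanSpace ℝ (Fin M)) : ℝ :=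
  liminf (fun i => ∫ ω, (J (A.iter i ω) - J wo) ∂P) atTop

end AsyncSGD

/-- The asynchronous step-size parameter `μ_x = μbar + σμ² / μbar`. -/
def muX (μbar σμ : ℝ) : ℝ := μbar + σμ ^ 2 / μbar

/-- The convergence rate `α = 1 - 2 ν μbar + (δ² + β²)(μbar² + σμ²)`. -/
def alphaAsyn (ν δ β μbar σμ : ℝ) : ℝ :=
  1 - 2 * ν * μbar + (δ ^ 2 + β ^ 2) * (μbar ^ 2 + σμ ^ 2)

namespace AsyncSGD

variable {Ω : Type*} [MeasurableSpace Ω] {M : ℕ}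

/-- Fourth-order moment conditions on the gradient noise and on the step-sizes. -/
structure FourthMomentConditions (A : AsyncSGD Ω M) (P : Measure Ω)
    (J : EuclideanSpace ℝ (Fin M) → ℝ) (wo : EuclideanSpace ℝ (Fin M))
    (β₄ σ₄ ρ μbar σμ : ℝ) : Prop where
  noise_le : ∀ i, ∀ᵐ ω ∂P,
    condLExp (A.past i) P (fun ω' => ‖A.noise J i (A.iter i ω') ω'‖ₑ ^ 4) ω
      ≤ ENNReal.ofReal (β₄ ^ 4 * ‖A.err wo i ω‖ ^ 4 + σ₄ ^ 4)
  step_le : ∀ i, ∫ ω, A.step i ω ^ 4 ∂P ≤ ρ * μbar * muX μbar σμ ^ 2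

end AsyncSGD

section Smoothness

open scoped Matrix.Norms.L2Operator

/-- The Hessian matrix of `J` is Lipschitz at `wo` (in the spectral norm) on the ball of
radius `r`. -/
def HessianLipschitzAt {M : ℕ} (J : EuclideanSpace ℝ (Fin M) → ℝ)
    (wo : EuclideanSpace ℝ (Fin M)) (τ r : ℝ) : Prop :=
  ∀ dw : EuclideanSpace ℝ (Fin M), ‖dw‖ ≤ r →
    ‖hessianMatrix J (wo + dw) - hessianMatrix J wo‖ ≤ τ * ‖dw‖

/-- The conditional noise covariance satisfies, in the spectral norm and almost surely,
`‖R_{s,i}(wo + dw) - R_{s,i}(wo)‖ ≤ τ₂ ‖dw‖^κ` for perturbations of size at most `r`. Since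
`R_{s,i}` is evaluated at the random iterates, `dw` may depend on the past; conditional second
moments are compared where they are defined, that is where the noise is square-integrable. -/
def AsyncSGD.CovLipschitzAt {Ω : Type*} [MeasurableSpace Ω] {M : ℕ} (A : AsyncSGD Ω M)
    (P : Measure Ω) (J : EuclideanSpace ℝ (Fin M) → ℝ) (wo : EuclideanSpace ℝ (Fin M))
    (τ₂ κ r : ℝ) : Prop :=
  ∀ (i : ℕ) (dw : Ω → EuclideanSpace ℝ (Fin M)), Measurable[A.past i] dw →
    (∀ ω, ‖dw ω‖ ≤ r) → MemLp (fun ω => A.noise J i (wo + dw ω) ω) 2 P →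
    ∀ᵐ ω ∂P, ‖A.condCov P J i (fun ω' => wo + dw ω') ω - A.condCov P J i (fun _ => wo) ω‖
      ≤ τ₂ * ‖dw ω‖ ^ κ

end Smoothness

end

/-!
The update `err ↦ err + μ(i) • (∇J + s)` splits conditionally on the past, because the step-size is
independent of the rest of the update and the noise has mean zero. The resulting scalar recursions
for `E ‖err‖²` and `E ‖err‖⁴` contract at a rate proportional to `μbar` and give `E ‖err‖² = O(μ_x)`
and `E ‖err‖⁴ = O(μ_x²)` in steady state.

Along a unit eigenvector `u` of the Hessian at `wo`, with eigenvalue `λ`, replacing the gradient by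
its linearization turns the same recursion into `x ↦ (1 - 2 λ μbar) x + μbar μ_x uᵀ R_s u` for the
mode `x = E ⟪u, err⟫²`, up to a perturbation of size `μbar · O(μ_x^(3/2))`. Its fixed point is
`μ_x uᵀ R_s u / (2 λ)`. Summing over an eigenbasis gives `μ_x / 2 · Tr (H⁻¹ R_s)`, and summing with
the weights `λ / 2` of the quadratic part of the cost gives `μ_x / 4 · Tr R_s`.
-/

open scoped RealInnerProductSpace

/-! ### Second-order Taylor remainders -/

section Remainders

variable {E : Type*} [NormedAddCommGroup E] [InnerProductSpace ℝ E]

theorem opNorm_le_of_abs_inner_le {T : E →L[ℝ] E} (hT : T.IsSymmetric) {C : ℝ} (hC : 0 ≤ C)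
    (h : ∀ x, |⟪T x, x⟫| ≤ C * ‖x‖ ^ 2) : ‖T‖ ≤ C := by
  rw [T.norm_eq_iSup_rayleighQuotient hT]
  refine ciSup_le fun x => ?_
  rw [ContinuousLinearMap.rayleighQuotient, abs_div, abs_sq]
  exact div_le_of_le_mul₀ (sq_nonneg _) hC (h x)

theorem mul_norm_sub_sq_le_inner_sub {G : E → E} {ν : ℝ} (hG : Differentiable ℝ G)
    (h : ∀ w x, ν * ‖x‖ ^ 2 ≤ ⟪x, fderiv ℝ G w x⟫) (v w : E) :
    ν * ‖w - v‖ ^ 2 ≤ ⟪w - v, G w - G v⟫ := by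
  set d := w - v with hd
  have hderiv : ∀ t : ℝ, HasDerivAt (fun t : ℝ => ⟪d, G (v + t • d)⟫)
      ⟪d, fderiv ℝ G (v + t • d) d⟫ t := fun t => by
    have hline : HasDerivAt (fun t : ℝ => v + t • d) d t := by
      simpa using ((hasDerivAt_id t).smul_const d).const_add v
    exact (innerSL ℝ d).hasFDerivAt.comp_hasDerivAt t
      ((hG (v + t • d)).hasFDerivAt.comp_hasDerivAt t hline)
  obtain ⟨c, -, hc⟩ := exists_hasDerivAt_eq_slope _ _ one_pos
    (fun t _ => (hderiv t).continuousAt.continuousWithinAt) (fun t _ => hderiv t)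
  calc ν * ‖d‖ ^ 2 ≤ ⟪d, fderiv ℝ G (v + c • d) d⟫ := h _ d
    _ = ⟪d, G w - G v⟫ := by rw [hc]; simp [hd, inner_sub_right]

variable [CompleteSpace E]

/-- The deviation of the gradient of `J` from its linearization at a critical point `wo`. -/
noncomputable def gradientRemainder (J : E → ℝ) (wo w : E) : E :=
  gradient J w - fderiv ℝ (gradient J) wo (w - wo)

/-- The deviation of `J` from its second-order Taylor polynomial at a critical point `wo`. -/
noncomputable def costRemainder (J : E → ℝ) (wo w : E) : ℝ :=
  J w - J wo - 1 / 2 * ⟪w - wo, fderiv ℝ (gradient J) wo (w - wo)⟫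

variable {J : E → ℝ} {wo w : E}

theorem abs_sub_le_of_norm_gradient_le {δ : ℝ} (hJ : Differentiable ℝ J) (hδ : 0 ≤ δ)
    (h : ∀ x, ‖gradient J x‖ ≤ δ * ‖x - wo‖) (w : E) : |J w - J wo| ≤ δ * ‖w - wo‖ ^ 2 := by
  have hball : ∀ x ∈ Metric.closedBall wo ‖w - wo‖, ‖fderiv ℝ J x‖ ≤ δ * ‖w - wo‖ :=
    fun x hx => by
      rw [mem_closedBall_iff_norm] at hx
      calc ‖fderiv ℝ J x‖ = ‖gradient J x‖ := by rw [gradient, LinearIsometryEquiv.norm_map]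
        _ ≤ δ * ‖x - wo‖ := h x
        _ ≤ δ * ‖w - wo‖ := by gcongr
  calc |J w - J wo| ≤ δ * ‖w - wo‖ * ‖w - wo‖ :=
        (convex_closedBall _ _).norm_image_sub_le_of_norm_fderiv_le (fun x _ => hJ x) hball
          (Metric.mem_closedBall_self (norm_nonneg _)) (mem_closedBall_iff_norm.mpr le_rfl)
    _ = δ * ‖w - wo‖ ^ 2 := by ring

theorem norm_gradientRemainder_le {C : ℝ} (hG : Differentiable ℝ (gradient J))
    (h0 : gradient J wo = 0)
    (hC : ∀ x, ‖x - wo‖ ≤ ‖w - wo‖ → ‖fderiv ℝ (gradient J) x - fderiv ℝ (gradient J) wo‖ ≤ C) :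
    ‖gradientRemainder J wo w‖ ≤ C * ‖w - wo‖ := by
  simpa [gradientRemainder, h0] using
    (convex_closedBall wo ‖w - wo‖).norm_image_sub_le_of_norm_fderiv_le' (fun x _ => hG x)
      (fun x hx => hC x (mem_closedBall_iff_norm.mp hx))
      (Metric.mem_closedBall_self (norm_nonneg _)) (mem_closedBall_iff_norm.mpr le_rfl)

theorem hasFDerivAt_costRemainder (hJ : DifferentiableAt ℝ J w)
    (hsymm : (fderiv ℝ (gradient J) wo).IsSymmetric) :
    HasFDerivAt (costRemainder J wo) (innerSL ℝ (gradientRemainder J wo w)) w := by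
  have hid := (hasFDerivAt_id (𝕜 := ℝ) w).sub_const wo
  have hquad := (hid.inner ℝ ((fderiv ℝ (gradient J) wo).hasFDerivAt.comp w hid)).const_mul (1 / 2)
  refine ((hJ.hasGradientAt.hasFDerivAt.sub_const (J wo)).sub hquad).congr_fderiv ?_
  ext d
  have hswap : ⟪w - wo, fderiv ℝ (gradient J) wo d⟫ = ⟪d, fderiv ℝ (gradient J) wo (w - wo)⟫ :=
    (hsymm _ _).symm.trans (real_inner_comm _ _)
  simp only [gradientRemainder, id_eq, ContinuousLinearMap.coe_id', Function.comp_apply,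
    sub_apply, smul_apply, ContinuousLinearMap.comp_apply,
    ContinuousLinearMap.prod_apply, fderivInnerCLM_apply, innerSL_apply_apply, inner_sub_left,
    InnerProductSpace.toDual_apply_apply, smul_eq_mul, hswap]
  rw [real_inner_comm d (fderiv ℝ (gradient J) wo (w - wo))]
  ring

theorem abs_costRemainder_le {C : ℝ} (hJ : Differentiable ℝ J)
    (hsymm : (fderiv ℝ (gradient J) wo).IsSymmetric)
    (hC : ∀ x, ‖x - wo‖ ≤ ‖w - wo‖ → ‖gradientRemainder J wo x‖ ≤ C) :
    |costRemainder J wo w| ≤ C * ‖w - wo‖ := by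
  simpa [costRemainder] using
    (convex_closedBall wo ‖w - wo‖).norm_image_sub_le_of_norm_hasFDerivWithin_le
      (fun x _ => (hasFDerivAt_costRemainder (hJ x) hsymm).hasFDerivWithinAt)
      (fun x hx => by
        rw [innerSL_apply_norm]
        exact hC x (mem_closedBall_iff_norm.mp hx))
      (Metric.mem_closedBall_self (norm_nonneg _)) (mem_closedBall_iff_norm.mpr le_rfl)

end Remainders

/-! ### Quadratic forms and the Hessian -/

section QuadForm

variable {M : ℕ}

/-- The quadratic form `uᵀ R u` of a real square matrix `R`. -/
noncomputable def quadForm (R : Matrix (Fin M) (Fin M) ℝ) (u : EuclideanSpace ℝ (Fin M)) : ℝ :=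
  ⟪u, Matrix.toEuclideanCLM (𝕜 := ℝ) R u⟫

theorem quadForm_eq_sum (R : Matrix (Fin M) (Fin M) ℝ) (u : EuclideanSpace ℝ (Fin M)) :
    quadForm R u = ∑ m, ∑ n, u m * R m n * u n := by
  rw [quadForm, Matrix.inner_toEuclideanCLM]
  simp only [dotProduct, Matrix.mulVec, Finset.mul_sum, mul_assoc]

theorem quadForm_sub (R S : Matrix (Fin M) (Fin M) ℝ) (u : EuclideanSpace ℝ (Fin M)) :
    quadForm (R - S) u = quadForm R u - quadForm S u := by
  simp only [quadForm, map_sub, sub_apply, inner_sub_right]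

open scoped Matrix.Norms.L2Operator in
theorem abs_quadForm_le (R : Matrix (Fin M) (Fin M) ℝ) (u : EuclideanSpace ℝ (Fin M)) :
    |quadForm R u| ≤ ‖R‖ * ‖u‖ ^ 2 :=
  calc |quadForm R u| ≤ ‖u‖ * ‖Matrix.toEuclideanCLM (𝕜 := ℝ) R u‖ := abs_real_inner_le_norm _ _
    _ ≤ ‖u‖ * (‖R‖ * ‖u‖) := by
      gcongr
      exact ContinuousLinearMap.le_opNorm _ _
    _ = ‖R‖ * ‖u‖ ^ 2 := by ring

theorem trace_eq_sum_quadForm (R : Matrix (Fin M) (Fin M) ℝ)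
    (b : OrthonormalBasis (Fin M) ℝ (EuclideanSpace ℝ (Fin M))) :
    R.trace = ∑ k, quadForm R (b k) := by
  let T := (Matrix.toEuclideanCLM (𝕜 := ℝ) R).toLinearMap
  have hstd := T.trace_eq_sum_inner (EuclideanSpace.basisFun (Fin M) ℝ)
  simp only [T, ContinuousLinearMap.coe_coe, Matrix.inner_toEuclideanCLM] at hstd
  calc R.trace = LinearMap.trace ℝ _ T := by rw [hstd]; simp [Matrix.trace]
    _ = ∑ k, quadForm R (b k) := T.trace_eq_sum_inner b

theorem trace_inv_mul_eq_sum_quadForm_div {H : Matrix (Fin M) (Fin M) ℝ} (hH : IsUnit H)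
    (R : Matrix (Fin M) (Fin M) ℝ) {b : OrthonormalBasis (Fin M) ℝ (EuclideanSpace ℝ (Fin M))}
    {lam : Fin M → ℝ} (hb : ∀ k, Matrix.toEuclideanCLM (𝕜 := ℝ) H (b k) = lam k • b k) :
    (H⁻¹ * R).trace = ∑ k, quadForm R (b k) / lam k := by
  rw [Matrix.trace_mul_comm, trace_eq_sum_quadForm _ b]
  refine Finset.sum_congr rfl fun k _ => ?_
  have hcancel : b k = lam k • Matrix.toEuclideanCLM (𝕜 := ℝ) H⁻¹ (b k) := by
    rw [← map_smul, ← hb, ← mul_apply_eq_comp, ← map_mul,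
      Matrix.nonsing_inv_mul _ ((Matrix.isUnit_iff_isUnit_det _).mp hH), map_one,
      one_apply_eq_self]
  have hlam : lam k ≠ 0 := fun h => b.orthonormal.ne_zero k (by rw [hcancel, h, zero_smul])
  have hinv : Matrix.toEuclideanCLM (𝕜 := ℝ) H⁻¹ (b k) = (lam k)⁻¹ • b k := by
    rw [eq_inv_smul_iff₀ hlam, ← hcancel]
  rw [quadForm, map_mul, mul_apply_eq_comp, hinv, map_smul, real_inner_smul_right,
    quadForm, div_eq_inv_mul]

theorem toEuclideanCLM_hessianMatrix (J : EuclideanSpace ℝ (Fin M) → ℝ)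
    (w : EuclideanSpace ℝ (Fin M)) :
    Matrix.toEuclideanCLM (𝕜 := ℝ) (hessianMatrix J w) = fderiv ℝ (gradient J) w := by
  apply ContinuousLinearMap.coe_injective
  apply (EuclideanSpace.basisFun (Fin M) ℝ).toBasis.ext
  intro n
  ext m
  simp [hessianMatrix, Matrix.mulVec_single]

end QuadForm

namespace HessianLipschitzAt

open scoped Matrix.Norms.L2Operator in
theorem norm_fderiv_gradient_sub_le {M : ℕ} {J : EuclideanSpace ℝ (Fin M) → ℝ}
    {wo w : EuclideanSpace ℝ (Fin M)} {τ r : ℝ} (hH : HessianLipschitzAt J wo τ r)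
    (hw : ‖w - wo‖ ≤ r) :
    ‖fderiv ℝ (gradient J) w - fderiv ℝ (gradient J) wo‖ ≤ τ * ‖w - wo‖ := by
  simpa only [add_sub_cancel, Matrix.cstar_norm_def, map_sub, toEuclideanCLM_hessianMatrix]
    using hH (w - wo) hw

end HessianLipschitzAt

namespace CostConditions

variable {M : ℕ} {J : EuclideanSpace ℝ (Fin M) → ℝ} {wo : EuclideanSpace ℝ (Fin M)} {ν δ : ℝ}

theorem pos_upper (h : CostConditions J wo ν δ) : 0 < δ := h.pos.trans_le h.le

theorem gradient_minimizer (h : CostConditions J wo ν δ) : gradient J wo = 0 := by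
  have hmin : IsLocalMin J wo := Eventually.of_forall h.minimizer
  rw [gradient, hmin.fderiv_eq_zero, map_zero]

theorem hessianMatrix_posDef (h : CostConditions J wo ν δ) (w : EuclideanSpace ℝ (Fin M)) :
    (hessianMatrix J w).PosDef := by
  simpa using Matrix.PosDef.posSemidef_add (h.lower w) (Matrix.PosDef.one.smul h.pos)

theorem isSymmetric_hessian (h : CostConditions J wo ν δ) (w : EuclideanSpace ℝ (Fin M)) :
    (fderiv ℝ (gradient J) w).IsSymmetric := by
  rw [← toEuclideanCLM_hessianMatrix]
  exact Matrix.isSymmetric_toEuclideanLin_iff.mpr (h.hessianMatrix_posDef w).isHermitian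

theorem mul_norm_sq_le_inner_hessian (h : CostConditions J wo ν δ)
    (w x : EuclideanSpace ℝ (Fin M)) : ν * ‖x‖ ^ 2 ≤ ⟪x, fderiv ℝ (gradient J) w x⟫ := by
  have hpos : 0 ≤ quadForm (hessianMatrix J w - ν • 1) x :=
    (Matrix.isPositive_toEuclideanLin_iff.mpr (h.lower w)).re_inner_nonneg_right x
  simpa [quadForm, inner_sub_right, real_inner_smul_right, toEuclideanCLM_hessianMatrix] using hpos

theorem inner_hessian_le_mul_norm_sq (h : CostConditions J wo ν δ)
    (w x : EuclideanSpace ℝ (Fin M)) : ⟪x, fderiv ℝ (gradient J) w x⟫ ≤ δ * ‖x‖ ^ 2 := by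
  have hpos : 0 ≤ quadForm (δ • 1 - hessianMatrix J w) x :=
    (Matrix.isPositive_toEuclideanLin_iff.mpr (h.upper w)).re_inner_nonneg_right x
  simpa [quadForm, inner_sub_right, real_inner_smul_right, toEuclideanCLM_hessianMatrix] using hpos

theorem norm_hessian_le (h : CostConditions J wo ν δ) (w : EuclideanSpace ℝ (Fin M)) :
    ‖fderiv ℝ (gradient J) w‖ ≤ δ := by
  refine opNorm_le_of_abs_inner_le (h.isSymmetric_hessian w) h.pos_upper.le fun x => ?_
  rw [real_inner_comm, abs_of_nonneg ((mul_nonneg h.pos.le (sq_nonneg _)).trans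
    (h.mul_norm_sq_le_inner_hessian w x))]
  exact h.inner_hessian_le_mul_norm_sq w x

theorem measurable_gradient (h : CostConditions J wo ν δ) : Measurable (gradient J) :=
  h.differentiable_gradient.continuous.measurable

theorem norm_gradient_le (h : CostConditions J wo ν δ) (w : EuclideanSpace ℝ (Fin M)) :
    ‖gradient J w‖ ≤ δ * ‖w - wo‖ := by
  simpa [h.gradient_minimizer] using convex_univ.norm_image_sub_le_of_norm_fderiv_le
    (fun x _ => h.differentiable_gradient x) (fun x _ => h.norm_hessian_le x)
    (Set.mem_univ wo) (Set.mem_univ w)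

theorem mul_norm_sq_le_inner_gradient (h : CostConditions J wo ν δ)
    (w : EuclideanSpace ℝ (Fin M)) : ν * ‖w - wo‖ ^ 2 ≤ ⟪w - wo, gradient J w⟫ := by
  simpa [h.gradient_minimizer] using mul_norm_sub_sq_le_inner_sub h.differentiable_gradient
    h.mul_norm_sq_le_inner_hessian wo w

theorem abs_sub_le (h : CostConditions J wo ν δ) (w : EuclideanSpace ℝ (Fin M)) :
    |J w - J wo| ≤ δ * ‖w - wo‖ ^ 2 :=
  abs_sub_le_of_norm_gradient_le h.differentiable h.pos_upper.le h.norm_gradient_le w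

theorem exists_eigenbasis (h : CostConditions J wo ν δ) :
    ∃ (b : OrthonormalBasis (Fin M) ℝ (EuclideanSpace ℝ (Fin M))) (lam : Fin M → ℝ),
      (∀ k, fderiv ℝ (gradient J) wo (b k) = lam k • b k) ∧ ∀ k, lam k ∈ Set.Icc ν δ := by
  have hH := (h.hessianMatrix_posDef wo).isHermitian
  have heig : ∀ k, fderiv ℝ (gradient J) wo (hH.eigenvectorBasis k)
      = hH.eigenvalues k • hH.eigenvectorBasis k := fun k => by
    ext j
    simpa [← toEuclideanCLM_hessianMatrix] using congrFun (hH.mulVec_eigenvectorBasis k) j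
  have hinner : ∀ k, ⟪hH.eigenvectorBasis k, fderiv ℝ (gradient J) wo (hH.eigenvectorBasis k)⟫
      = hH.eigenvalues k := fun k => by simp [heig, real_inner_smul_right]
  refine ⟨hH.eigenvectorBasis, hH.eigenvalues, heig, fun k => ⟨?_, ?_⟩⟩
  · simpa [hinner] using h.mul_norm_sq_le_inner_hessian wo (hH.eigenvectorBasis k)
  · simpa [hinner] using h.inner_hessian_le_mul_norm_sq wo (hH.eigenvectorBasis k)

theorem norm_gradientRemainder_le_linear (h : CostConditions J wo ν δ)
    (w : EuclideanSpace ℝ (Fin M)) : ‖gradientRemainder J wo w‖ ≤ 2 * δ * ‖w - wo‖ :=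
  norm_gradientRemainder_le h.differentiable_gradient h.gradient_minimizer fun x _ =>
    (norm_sub_le _ _).trans (by linarith [h.norm_hessian_le x, h.norm_hessian_le wo])

theorem gradientRemainder_eq_zero (h : CostConditions J wo ν δ)
    (hconst : ∀ w, hessianMatrix J w = hessianMatrix J wo) (w : EuclideanSpace ℝ (Fin M)) :
    gradientRemainder J wo w = 0 := by
  simpa using norm_gradientRemainder_le (w := w) (C := 0) h.differentiable_gradient
    h.gradient_minimizer fun x _ => by simp [← toEuclideanCLM_hessianMatrix, hconst x]

theorem costRemainder_eq_zero (h : CostConditions J wo ν δ)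
    (hconst : ∀ w, hessianMatrix J w = hessianMatrix J wo) (w : EuclideanSpace ℝ (Fin M)) :
    costRemainder J wo w = 0 := by
  simpa using abs_costRemainder_le (w := w) (C := 0) h.differentiable (h.isSymmetric_hessian wo)
    fun x _ => by rw [h.gradientRemainder_eq_zero hconst, norm_zero]

section HessianLipschitz

variable {τ r : ℝ}

theorem norm_gradientRemainder_le_quadratic (h : CostConditions J wo ν δ) (hr : 0 < r)
    (hτ : 0 ≤ τ) (hH : HessianLipschitzAt J wo τ r) (w : EuclideanSpace ℝ (Fin M)) :
    ‖gradientRemainder J wo w‖ ≤ (τ + 2 * δ / r) * ‖w - wo‖ ^ 2 := by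
  have hδ := h.pos_upper
  rcases le_total ‖w - wo‖ r with hw | hw
  · calc ‖gradientRemainder J wo w‖ ≤ τ * ‖w - wo‖ * ‖w - wo‖ :=
          norm_gradientRemainder_le h.differentiable_gradient h.gradient_minimizer fun x hx =>
            (hH.norm_fderiv_gradient_sub_le (hx.trans hw)).trans (by gcongr)
      _ = τ * ‖w - wo‖ ^ 2 := by ring
      _ ≤ (τ + 2 * δ / r) * ‖w - wo‖ ^ 2 := by
        gcongr
        exact le_add_of_nonneg_right (by positivity)
  · calc ‖gradientRemainder J wo w‖ ≤ 2 * δ * ‖w - wo‖ := h.norm_gradientRemainder_le_linear w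
      _ = 2 * δ / r * (r * ‖w - wo‖) := by field_simp
      _ ≤ 2 * δ / r * (‖w - wo‖ * ‖w - wo‖) := by gcongr
      _ = 2 * δ / r * ‖w - wo‖ ^ 2 := by ring
      _ ≤ (τ + 2 * δ / r) * ‖w - wo‖ ^ 2 := by
        gcongr
        exact le_add_of_nonneg_left hτ

theorem norm_gradientRemainder_le_min (h : CostConditions J wo ν δ) (hr : 0 < r)
    (hτ : 0 ≤ τ) (hH : HessianLipschitzAt J wo τ r) (w : EuclideanSpace ℝ (Fin M)) :
    ‖gradientRemainder J wo w‖
      ≤ (τ + 2 * δ / r + 2 * δ) * min ‖w - wo‖ (‖w - wo‖ ^ 2) := by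
  have hδ := h.pos_upper
  have hK : 0 ≤ τ + 2 * δ / r := by positivity
  rw [mul_min_of_nonneg _ _ (by positivity), le_min_iff]
  refine ⟨(h.norm_gradientRemainder_le_linear w).trans ?_,
    (h.norm_gradientRemainder_le_quadratic hr hτ hH w).trans ?_⟩
  · gcongr
    exact le_add_of_nonneg_left hK
  · exact mul_le_mul_of_nonneg_right (le_add_of_nonneg_right (by positivity)) (sq_nonneg _)

theorem abs_costRemainder_le_min (h : CostConditions J wo ν δ) (hr : 0 < r)
    (hτ : 0 ≤ τ) (hH : HessianLipschitzAt J wo τ r) (w : EuclideanSpace ℝ (Fin M)) :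
    |costRemainder J wo w|
      ≤ (τ + 2 * δ / r + 2 * δ) * min (‖w - wo‖ ^ 2) (‖w - wo‖ ^ 3) := by
  have hδ := h.pos_upper
  calc |costRemainder J wo w|
      ≤ (τ + 2 * δ / r + 2 * δ) * min ‖w - wo‖ (‖w - wo‖ ^ 2) * ‖w - wo‖ :=
        abs_costRemainder_le h.differentiable (h.isSymmetric_hessian wo) fun x hx =>
          (h.norm_gradientRemainder_le_min hr hτ hH x).trans (by gcongr)
    _ = (τ + 2 * δ / r + 2 * δ) * min (‖w - wo‖ ^ 2) (‖w - wo‖ ^ 3) := by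
      rw [mul_assoc, min_mul_of_nonneg _ _ (norm_nonneg _)]
      ring_nf

end HessianLipschitz

end CostConditions

/-! ### Perturbed contractions and moments -/

section Sequences

theorem eventually_le_of_le_contraction {y : ℕ → ℝ} {a b c : ℝ} (ha : 0 < a) (ha1 : a ≤ 1)
    (hc : b / a < c) (hy : ∀ᶠ i in atTop, y (i + 1) ≤ (1 - a) * y i + b) :
    ∀ᶠ i in atTop, y i ≤ c := by
  obtain ⟨N, hN⟩ := eventually_atTop.mp hy
  have hgeom : ∀ n, y (n + N) - b / a ≤ (1 - a) ^ n * (y N - b / a) := fun n => by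
    simpa using le_geom (u := fun n => y (n + N) - b / a) (sub_nonneg.mpr ha1) n fun k _ => by
      have hstep := hN (k + N) (by omega)
      have hfix : (1 - a) * (b / a) = b / a - b := by field_simp
      rw [mul_sub, hfix, add_right_comm]
      linarith
  have hlim : Tendsto (fun n : ℕ => (1 - a) ^ n * (y N - b / a)) atTop (𝓝 0) := by
    simpa using (tendsto_pow_atTop_nhds_zero_of_lt_one (by linarith) (by linarith)).mul_const
      (y N - b / a)
  rw [← map_add_atTop_eq_nat N, eventually_map]
  filter_upwards [hlim.eventually_lt_const (sub_pos.mpr hc)] with n hn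
  linarith [hgeom n]

theorem eventually_abs_sub_le_of_contraction {x e : ℕ → ℝ} {a b c L : ℝ} (ha : 0 < a)
    (ha1 : a ≤ 1) (hc : b / a < c)
    (hx : ∀ᶠ i in atTop, x (i + 1) - L = (1 - a) * (x i - L) + e i)
    (he : ∀ᶠ i in atTop, |e i| ≤ b) :
    ∀ᶠ i in atTop, |x i - L| ≤ c := by
  refine eventually_le_of_le_contraction (y := fun i => |x i - L|) ha ha1 hc ?_
  filter_upwards [hx, he] with i hxi hei
  calc |x (i + 1) - L| ≤ |(1 - a) * (x i - L)| + |e i| := hxi ▸ abs_add_le _ _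
    _ ≤ (1 - a) * |x i - L| + b := by
      rw [abs_mul, abs_of_nonneg (sub_nonneg.mpr ha1)]
      gcongr

theorem abs_limsup_sub_le_and_abs_liminf_sub_le {x : ℕ → ℝ} {L c : ℝ}
    (h : ∀ᶠ i in atTop, |x i - L| ≤ c) :
    |limsup x atTop - L| ≤ c ∧ |liminf x atTop - L| ≤ c := by
  have hupper : ∀ᶠ i in atTop, x i ≤ L + c := h.mono fun i hi => by linarith [(abs_le.mp hi).2]
  have hlower : ∀ᶠ i in atTop, L - c ≤ x i := h.mono fun i hi => by linarith [(abs_le.mp hi).1]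
  have hbdd : IsBoundedUnder (· ≤ ·) atTop x := ⟨L + c, by simpa using hupper⟩
  have hbdd' : IsBoundedUnder (· ≥ ·) atTop x := ⟨L - c, by simpa using hlower⟩
  have hlimsup : limsup x atTop ≤ L + c := limsup_le_of_le hbdd'.isCoboundedUnder_le hupper
  have hliminf : L - c ≤ liminf x atTop := le_liminf_of_le hbdd.isCoboundedUnder_ge hlower
  have hle : liminf x atTop ≤ limsup x atTop := liminf_le_limsup hbdd hbdd'
  constructor <;> rw [abs_le] <;> constructor <;> linarith

theorem eventually_abs_sum_sub_le {ι : Type*} [Fintype ι] {x : ι → ℕ → ℝ} {w l : ι → ℝ}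
    {W c : ℝ} (hx : ∀ k, ∀ᶠ i in atTop, |x k i - l k| ≤ c) (hw : ∀ k, |w k| ≤ W) :
    ∀ᶠ i in atTop, |∑ k, w k * x k i - ∑ k, w k * l k| ≤ Fintype.card ι * (W * c) := by
  filter_upwards [eventually_all.mpr hx] with i hi
  rw [← Finset.sum_sub_distrib, ← nsmul_eq_mul, ← Finset.card_univ]
  refine (Finset.abs_sum_le_sum_abs _ _).trans (Finset.sum_le_card_nsmul _ _ _ fun k _ => ?_)
  rw [← mul_sub, abs_mul]
  exact mul_le_mul (hw k) (hi k) (abs_nonneg _) ((abs_nonneg _).trans (hw k))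

end Sequences

section Indicator

variable {Ω E : Type*} [NormedAddCommGroup E] {e q : Ω → E} {c : ℝ}

theorem norm_indicator_le_mul_norm_indicator (h : ∀ ω, ‖q ω‖ ≤ c * ‖e ω‖) (B : Set Ω) (ω : Ω) :
    ‖B.indicator q ω‖ ≤ c * ‖B.indicator e ω‖ := by
  by_cases hω : ω ∈ B <;> simp [hω, h]

variable [InnerProductSpace ℝ E]

theorem indicator_add_smul_indicator_add (e q s : Ω → E) (t : Ω → ℝ) (B : Set Ω) (ω : Ω) :
    B.indicator e ω + t ω • (B.indicator q ω + B.indicator s ω)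
      = B.indicator (fun ω => e ω + t ω • (q ω + s ω)) ω := by
  by_cases hω : ω ∈ B <;> simp [hω]

theorem inner_indicator_le (h : ∀ ω, ⟪e ω, q ω⟫ ≤ c * ‖e ω‖ ^ 2) (B : Set Ω) (ω : Ω) :
    ⟪B.indicator e ω, B.indicator q ω⟫ ≤ c * ‖B.indicator e ω‖ ^ 2 := by
  by_cases hω : ω ∈ B <;> simp [hω, h]

end Indicator

section Moments

variable {Ω E : Type*} [MeasurableSpace Ω] [NormedAddCommGroup E] {P : Measure Ω} {f g : Ω → E}

theorem memLp_two_norm_sq_of_memLp_four (hf : MemLp f 4 P) :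
    MemLp (fun ω => ‖f ω‖ ^ 2) 2 P := by
  refine (memLp_two_iff_integrable_sq (hf.1.norm.pow 2)).mpr ?_
  simpa only [Pi.pow_apply, ← pow_mul] using hf.integrable_norm_pow four_ne_zero

theorem integrable_norm_sq_mul_norm_sq (hf : MemLp f 4 P) (hg : MemLp g 4 P) :
    Integrable (fun ω => ‖f ω‖ ^ 2 * ‖g ω‖ ^ 2) P :=
  (memLp_two_norm_sq_of_memLp_four hf).integrable_mul (memLp_two_norm_sq_of_memLp_four hg)

theorem mul_integral_norm_sq_mul_norm_sq_le (hf : MemLp f 4 P) (hg : MemLp g 4 P) {ν : ℝ}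
    (hν : 0 < ν) (x : ℝ) :
    8 * x * ∫ ω, ‖f ω‖ ^ 2 * ‖g ω‖ ^ 2 ∂P
      ≤ ν * ∫ ω, ‖f ω‖ ^ 4 ∂P + 16 / ν * x ^ 2 * ∫ ω, ‖g ω‖ ^ 4 ∂P := by
  have hf4 := hf.integrable_norm_pow four_ne_zero
  have hg4 := hg.integrable_norm_pow four_ne_zero
  simp only [← integral_const_mul]
  rw [← integral_add (hf4.const_mul _) (hg4.const_mul _)]
  refine integral_mono ((integrable_norm_sq_mul_norm_sq hf hg).const_mul _)
    ((hf4.const_mul _).add (hg4.const_mul _)) fun ω => sub_nonneg.mp ?_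
  calc (0 : ℝ) ≤ (ν * ‖f ω‖ ^ 2 - 4 * x * ‖g ω‖ ^ 2) ^ 2 / ν := by positivity
    _ = ν * ‖f ω‖ ^ 4 + 16 / ν * x ^ 2 * ‖g ω‖ ^ 4
        - 8 * x * (‖f ω‖ ^ 2 * ‖g ω‖ ^ 2) := by field_simp; ring

theorem integral_norm_add_pow_four_le (hf : MemLp f 4 P) (hg : MemLp g 4 P) :
    ∫ ω, ‖f ω + g ω‖ ^ 4 ∂P ≤ 8 * (∫ ω, ‖f ω‖ ^ 4 ∂P + ∫ ω, ‖g ω‖ ^ 4 ∂P) := by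
  have hf4 := hf.integrable_norm_pow four_ne_zero
  have hg4 := hg.integrable_norm_pow four_ne_zero
  rw [← integral_add hf4 hg4, ← integral_const_mul]
  refine integral_mono ((hf.add hg).integrable_norm_pow four_ne_zero)
    ((hf4.add hg4).const_mul 8) fun ω => ?_
  calc ‖f ω + g ω‖ ^ 4 ≤ (‖f ω‖ + ‖g ω‖) ^ 4 := by gcongr; exact norm_add_le _ _
    _ ≤ 2 ^ (4 - 1) * (‖f ω‖ ^ 4 + ‖g ω‖ ^ 4) := add_pow_le (norm_nonneg _) (norm_nonneg _) 4
    _ = 8 * (‖f ω‖ ^ 4 + ‖g ω‖ ^ 4) := by norm_num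

theorem integral_norm_indicator_pow {B : Set Ω} (hB : MeasurableSet B) {k : ℕ} (hk : k ≠ 0) :
    ∫ ω, ‖B.indicator f ω‖ ^ k ∂P = ∫ ω in B, ‖f ω‖ ^ k ∂P := by
  rw [← integral_indicator hB]
  congr with ω
  by_cases hω : ω ∈ B <;> simp [hω, hk]

section InnerProductSpace

variable [InnerProductSpace ℝ E]

theorem integrable_inner_of_memLp_two (hf : MemLp f 2 P) (hg : MemLp g 2 P) :
    Integrable (fun ω => ⟪f ω, g ω⟫) P :=
  (hf.norm.integrable_mul hg.norm).mono' (hf.1.inner hg.1)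
    (ae_of_all _ fun ω => abs_real_inner_le_norm (f ω) (g ω))

theorem integrable_norm_sq_mul_inner (hf : MemLp f 4 P) (hg : MemLp g 4 P) :
    Integrable (fun ω => ‖f ω‖ ^ 2 * ⟪f ω, g ω⟫) P := by
  refine ((integrable_norm_sq_mul_norm_sq hf hf).add
    (integrable_norm_sq_mul_norm_sq hf hg)).mono' ((hf.1.norm.pow 2).mul (hf.1.inner hg.1))
    (ae_of_all _ fun ω => ?_)
  rw [Pi.add_apply, norm_mul, norm_pow, norm_norm, ← mul_add]
  gcongr
  refine (abs_real_inner_le_norm _ _).trans ?_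
  nlinarith [sq_nonneg (‖f ω‖ - ‖g ω‖), mul_nonneg (norm_nonneg (f ω)) (norm_nonneg (g ω))]

theorem norm_add_smul_sq (e g : E) (t : ℝ) :
    ‖e + t • g‖ ^ 2 = ‖e‖ ^ 2 + 2 * (t * ⟪e, g⟫) + t ^ 2 * ‖g‖ ^ 2 := by
  rw [norm_add_sq_real, real_inner_smul_right, norm_smul, mul_pow, Real.norm_eq_abs, sq_abs]

theorem norm_add_smul_pow_four_le (e g : E) (t : ℝ) :
    ‖e + t • g‖ ^ 4 ≤ ‖e‖ ^ 4 + 4 * (t * (‖e‖ ^ 2 * ⟪e, g⟫))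
      + 8 * (t ^ 2 * (‖e‖ ^ 2 * ‖g‖ ^ 2)) + 3 * (t ^ 4 * ‖g‖ ^ 4) := by
  have hinner : ⟪e, g⟫ ^ 2 ≤ ‖e‖ ^ 2 * ‖g‖ ^ 2 := by
    rw [← mul_pow, ← sq_abs]
    exact pow_le_pow_left₀ (abs_nonneg _) (abs_real_inner_le_norm e g) 2
  have hpow : ‖e + t • g‖ ^ 4 = (‖e + t • g‖ ^ 2) ^ 2 := by ring
  rw [hpow, norm_add_smul_sq]
  nlinarith [sq_nonneg (t * ⟪e, g⟫ - t ^ 2 * ‖g‖ ^ 2),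
    mul_le_mul_of_nonneg_left hinner (sq_nonneg t)]

end InnerProductSpace

end Moments

section ConditionalMoments

variable {Ω E : Type*} {F : MeasurableSpace Ω} [m : MeasurableSpace Ω] [NormedAddCommGroup E]
  {P : Measure Ω} [IsFiniteMeasure P] {s : Ω → E} {k : ℕ} {c : Ω → ℝ} {B : Set Ω}

theorem setLIntegral_enorm_pow_le_of_condLExp_le (hF : F ≤ m) (hc0 : ∀ ω, 0 ≤ c ω)
    (h : ∀ᵐ ω ∂P, condLExp F P (fun ω' => ‖s ω'‖ₑ ^ k) ω ≤ ENNReal.ofReal (c ω))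
    (hB : MeasurableSet[F] B) (hc : IntegrableOn c B P) :
    ∫⁻ ω in B, ‖s ω‖ₑ ^ k ∂P ≤ ENNReal.ofReal (∫ ω in B, c ω ∂P) := by
  rw [← setLIntegral_condLExp hF P _ hB, ofReal_integral_eq_lintegral_ofReal hc (ae_of_all _ hc0)]
  exact lintegral_mono_ae (ae_restrict_of_ae h)

theorem memLp_restrict_of_condLExp_le (hF : F ≤ m) (hs : AEStronglyMeasurable s P) (hk : k ≠ 0)
    (hc0 : ∀ ω, 0 ≤ c ω)
    (h : ∀ᵐ ω ∂P, condLExp F P (fun ω' => ‖s ω'‖ₑ ^ k) ω ≤ ENNReal.ofReal (c ω))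
    (hB : MeasurableSet[F] B) (hc : IntegrableOn c B P) :
    MemLp s k (P.restrict B) := by
  refine ⟨hs.restrict, ?_⟩
  rw [eLpNorm_lt_top_iff_lintegral_rpow_enorm_lt_top (by exact_mod_cast hk)
    (ENNReal.natCast_ne_top k)]
  simpa only [ENNReal.toReal_natCast, ENNReal.rpow_natCast] using
    (setLIntegral_enorm_pow_le_of_condLExp_le hF hc0 h hB hc).trans_lt ENNReal.ofReal_lt_top

theorem setIntegral_norm_pow_le_of_condLExp_le (hF : F ≤ m) (hs : AEStronglyMeasurable s P)
    (hc0 : ∀ ω, 0 ≤ c ω)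
    (h : ∀ᵐ ω ∂P, condLExp F P (fun ω' => ‖s ω'‖ₑ ^ k) ω ≤ ENNReal.ofReal (c ω))
    (hB : MeasurableSet[F] B) (hc : IntegrableOn c B P) :
    ∫ ω in B, ‖s ω‖ ^ k ∂P ≤ ∫ ω in B, c ω ∂P := by
  have hmeas : AEStronglyMeasurable (fun ω => ‖s ω‖ ^ k) (P.restrict B) := (hs.norm.pow k).restrict
  have hnorm := integral_norm_eq_lintegral_enorm hmeas
  simp only [norm_pow, norm_norm, enorm_pow, enorm_norm] at hnorm
  rw [hnorm]
  exact ENNReal.toReal_le_of_le_ofReal (integral_nonneg hc0)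
    (setLIntegral_enorm_pow_le_of_condLExp_le hF hc0 h hB hc)

end ConditionalMoments

/-! ### Moments of one stochastic update -/

/-- One update `e + mu • (q + s)` of a stochastic recursion: `e` and `q` depend on the past `F`,
`s` is noise with zero conditional mean, and the bounded step-size `mu` is independent of the
σ-algebra `G` carrying all of these. -/
structure StochStep {Ω E : Type*} (F G : MeasurableSpace Ω) [m : MeasurableSpace Ω]
    [NormedAddCommGroup E] [InnerProductSpace ℝ E] [CompleteSpace E] (P : Measure Ω)
    (mu : Ω → ℝ) (ub : ℝ) (e q s : Ω → E) : Prop where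
  le : F ≤ G
  le_ambient : G ≤ m
  meas_e : StronglyMeasurable[F] e
  meas_q : StronglyMeasurable[F] q
  meas_s : StronglyMeasurable[G] s
  meas_mu : Measurable mu
  mem_Icc : ∀ᵐ ω ∂P, mu ω ∈ Set.Icc 0 ub
  indep : Indep (MeasurableSpace.comap mu inferInstance) G P
  memLp_e : MemLp e 2 P
  memLp_q : MemLp q 2 P
  memLp_s : MemLp s 2 P
  mean_zero : P[s | F] =ᵐ[P] 0

namespace StochStep

variable {Ω E E' : Type*} {F G : MeasurableSpace Ω} [m : MeasurableSpace Ω]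
  [NormedAddCommGroup E] [InnerProductSpace ℝ E] [CompleteSpace E]
  [NormedAddCommGroup E'] [InnerProductSpace ℝ E'] [CompleteSpace E']
  {P : Measure Ω} {mu : Ω → ℝ} {ub : ℝ} {e q s : Ω → E} {B : Set Ω}

theorem past_le (h : StochStep F G P mu ub e q s) : F ≤ m := h.le.trans h.le_ambient

theorem stronglyMeasurable_grad (h : StochStep F G P mu ub e q s) :
    StronglyMeasurable[G] fun ω => q ω + s ω :=
  (h.meas_q.mono h.le).add h.meas_s

theorem memLp_top_step (h : StochStep F G P mu ub e q s) {Q : Measure Ω} (hQ : Q ≪ P) :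
    MemLp mu ∞ Q := by
  refine memLp_top_of_bound h.meas_mu.aestronglyMeasurable ub ?_
  filter_upwards [hQ.ae_le h.mem_Icc] with ω hω
  rw [Real.norm_eq_abs, abs_of_nonneg hω.1]
  exact hω.2

theorem memLp_update (h : StochStep F G P mu ub e q s) {Q : Measure Ω} (hQ : Q ≪ P) {p : ℝ≥0∞}
    (he : MemLp e p Q) (hq : MemLp q p Q) (hs : MemLp s p Q) :
    MemLp (fun ω => e ω + mu ω • (q ω + s ω)) p Q :=
  he.add ((hq.add hs).smul (h.memLp_top_step hQ))

section FiniteMeasure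

variable [IsFiniteMeasure P]

theorem indicator (h : StochStep F G P mu ub e q s) (hB : MeasurableSet[F] B) :
    StochStep F G P mu ub (B.indicator e) (B.indicator q) (B.indicator s) where
  le := h.le
  le_ambient := h.le_ambient
  meas_e := h.meas_e.indicator hB
  meas_q := h.meas_q.indicator hB
  meas_s := h.meas_s.indicator (h.le _ hB)
  meas_mu := h.meas_mu
  mem_Icc := h.mem_Icc
  indep := h.indep
  memLp_e := h.memLp_e.indicator (h.past_le _ hB)
  memLp_q := h.memLp_q.indicator (h.past_le _ hB)
  memLp_s := h.memLp_s.indicator (h.past_le _ hB)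
  mean_zero := by
    filter_upwards [condExp_indicator (h.memLp_s.integrable one_le_two) hB, h.mean_zero]
      with ω hcond hzero
    rw [hcond]
    simp [Set.indicator, hzero]

theorem comp (h : StochStep F G P mu ub e q s) (L : E →L[ℝ] E') :
    StochStep F G P mu ub (fun ω => L (e ω)) (fun ω => L (q ω)) (fun ω => L (s ω)) where
  le := h.le
  le_ambient := h.le_ambient
  meas_e := L.continuous.comp_stronglyMeasurable h.meas_e
  meas_q := L.continuous.comp_stronglyMeasurable h.meas_q
  meas_s := L.continuous.comp_stronglyMeasurable h.meas_s
  meas_mu := h.meas_mu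
  mem_Icc := h.mem_Icc
  indep := h.indep
  memLp_e := L.comp_memLp' h.memLp_e
  memLp_q := L.comp_memLp' h.memLp_q
  memLp_s := L.comp_memLp' h.memLp_s
  mean_zero := by
    filter_upwards [L.comp_condExp_comm (h.memLp_s.integrable one_le_two) (m := F), h.mean_zero]
      with ω hcond hzero
    change P[L ∘ s | F] ω = 0
    rw [← hcond]
    simp [hzero]

theorem integral_inner_noise (h : StochStep F G P mu ub e q s) {f : Ω → E}
    (hf : StronglyMeasurable[F] f) (hfs : Integrable (fun ω => ⟪f ω, s ω⟫) P) :
    ∫ ω, ⟪f ω, s ω⟫ ∂P = 0 := by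
  have hpull := condExp_bilin_of_stronglyMeasurable_left (m := F) (innerSL ℝ) hf hfs
    (h.memLp_s.integrable one_le_two)
  rw [← integral_condExp h.past_le, integral_congr_ae (g := fun _ => (0 : ℝ)), integral_zero]
  filter_upwards [hpull, h.mean_zero] with ω hω hzero
  rw [hzero] at hω
  exact hω.trans (by simp)

theorem integrable_step_pow (h : StochStep F G P mu ub e q s) (k : ℕ) :
    Integrable (fun ω => mu ω ^ k) P := by
  refine (integrable_const (ub ^ k)).mono' (h.meas_mu.pow_const k).aestronglyMeasurable ?_
  filter_upwards [h.mem_Icc] with ω hω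
  rw [Real.norm_eq_abs, abs_of_nonneg (pow_nonneg hω.1 k)]
  exact pow_le_pow_left₀ hω.1 hω.2 k

theorem integral_norm_sq_grad (h : StochStep F G P mu ub e q s) :
    ∫ ω, ‖q ω + s ω‖ ^ 2 ∂P = ∫ ω, ‖q ω‖ ^ 2 ∂P + ∫ ω, ‖s ω‖ ^ 2 ∂P := by
  have hq := h.memLp_q.integrable_norm_pow two_ne_zero
  have hs := h.memLp_s.integrable_norm_pow two_ne_zero
  have hqs := integrable_inner_of_memLp_two h.memLp_q h.memLp_s
  simp_rw [norm_add_sq_real]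
  refine (integral_add (hq.add (hqs.const_mul 2)) hs).trans ?_
  rw [integral_add' hq (hqs.const_mul 2), integral_const_mul,
    h.integral_inner_noise h.meas_q hqs, mul_zero, add_zero]

end FiniteMeasure

section IndependentStep

theorem indepFun_step_pow (h : StochStep F G P mu ub e q s) (k : ℕ) {X : Ω → ℝ}
    (hX : StronglyMeasurable[G] X) : IndepFun (fun ω => mu ω ^ k) X P :=
  ((IndepFun_iff_Indep _ _ _).mpr
    (indep_of_indep_of_le_right h.indep hX.measurable.comap_le)).comp
      (measurable_id.pow_const k) measurable_id

theorem integral_step_pow_mul (h : StochStep F G P mu ub e q s) (k : ℕ) {X : Ω → ℝ}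
    (hX : StronglyMeasurable[G] X) :
    ∫ ω, mu ω ^ k * X ω ∂P = (∫ ω, mu ω ^ k ∂P) * ∫ ω, X ω ∂P :=
  (h.indepFun_step_pow k hX).integral_fun_mul_eq_mul_integral
    (h.meas_mu.pow_const k).aestronglyMeasurable
    (hX.mono h.le_ambient).aestronglyMeasurable

variable [IsFiniteMeasure P]

theorem integrable_step_pow_mul (h : StochStep F G P mu ub e q s) (k : ℕ) {X : Ω → ℝ}
    (hX : StronglyMeasurable[G] X) (hXi : Integrable X P) :
    Integrable (fun ω => mu ω ^ k * X ω) P :=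
  (h.indepFun_step_pow k hX).integrable_mul (h.integrable_step_pow k) hXi

theorem integral_norm_sq_update (h : StochStep F G P mu ub e q s) :
    ∫ ω, ‖e ω + mu ω • (q ω + s ω)‖ ^ 2 ∂P
      = ∫ ω, ‖e ω‖ ^ 2 ∂P + 2 * (∫ ω, mu ω ∂P) * ∫ ω, ⟪e ω, q ω⟫ ∂P
        + (∫ ω, mu ω ^ 2 ∂P) * (∫ ω, ‖q ω‖ ^ 2 ∂P + ∫ ω, ‖s ω‖ ^ 2 ∂P) := by
  have he := h.memLp_e.integrable_norm_pow two_ne_zero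
  have hg := (h.memLp_q.add h.memLp_s).integrable_norm_pow two_ne_zero
  have heg := integrable_inner_of_memLp_two h.memLp_e (h.memLp_q.add h.memLp_s)
  have heq := integrable_inner_of_memLp_two h.memLp_e h.memLp_q
  have hes := integrable_inner_of_memLp_two h.memLp_e h.memLp_s
  have hmeas : StronglyMeasurable[G] fun ω => ⟪e ω, q ω + s ω⟫ :=
    (h.meas_e.mono h.le).inner h.stronglyMeasurable_grad
  have hmeas_sq : StronglyMeasurable[G] fun ω => ‖q ω + s ω‖ ^ 2 :=
    h.stronglyMeasurable_grad.norm.pow 2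
  have hfirst := (h.integrable_step_pow_mul 1 hmeas heg).const_mul 2
  have hsecond := h.integrable_step_pow_mul 2 hmeas_sq hg
  have hmean := h.integral_step_pow_mul 1 hmeas
  simp only [pow_one] at hfirst hmean
  simp_rw [norm_add_smul_sq]
  refine (integral_add (he.add hfirst) hsecond).trans ?_
  rw [integral_add' he hfirst, integral_const_mul, hmean,
    h.integral_step_pow_mul 2 hmeas_sq, h.integral_norm_sq_grad]
  simp_rw [inner_add_right]
  rw [integral_add heq hes, h.integral_inner_noise h.meas_e hes]
  ring

theorem integral_norm_pow_four_update_le (h : StochStep F G P mu ub e q s)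
    (he : MemLp e 4 P) (hq : MemLp q 4 P) (hs : MemLp s 4 P) :
    ∫ ω, ‖e ω + mu ω • (q ω + s ω)‖ ^ 4 ∂P
      ≤ ∫ ω, ‖e ω‖ ^ 4 ∂P + 4 * (∫ ω, mu ω ∂P) * ∫ ω, ‖e ω‖ ^ 2 * ⟪e ω, q ω⟫ ∂P
        + 8 * (∫ ω, mu ω ^ 2 ∂P) * ∫ ω, ‖e ω‖ ^ 2 * ‖q ω + s ω‖ ^ 2 ∂P
        + 3 * (∫ ω, mu ω ^ 4 ∂P) * ∫ ω, ‖q ω + s ω‖ ^ 4 ∂P := by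
  have hg : MemLp (fun ω => q ω + s ω) 4 P := hq.add hs
  have he4 := he.integrable_norm_pow four_ne_zero
  have heq := integrable_norm_sq_mul_inner he hq
  have hes := integrable_norm_sq_mul_inner he hs
  have hnoise : ∫ ω, ‖e ω‖ ^ 2 * ⟪e ω, s ω⟫ ∂P = 0 := by
    simpa [real_inner_smul_left] using
      h.integral_inner_noise (f := fun ω => ‖e ω‖ ^ 2 • e ω)
        ((h.meas_e.norm.pow 2).smul h.meas_e) (by simpa [real_inner_smul_left] using hes)
  have hmeas_e := h.meas_e.mono h.le
  have hmeas_g := h.stronglyMeasurable_grad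
  have hmeas₁ : StronglyMeasurable[G] fun ω => ‖e ω‖ ^ 2 * ⟪e ω, q ω + s ω⟫ :=
    (hmeas_e.norm.pow 2).mul (hmeas_e.inner hmeas_g)
  have hmeas₂ : StronglyMeasurable[G] fun ω => ‖e ω‖ ^ 2 * ‖q ω + s ω‖ ^ 2 :=
    (hmeas_e.norm.pow 2).mul (hmeas_g.norm.pow 2)
  have hmeas₄ : StronglyMeasurable[G] fun ω => ‖q ω + s ω‖ ^ 4 := hmeas_g.norm.pow 4
  have hint₁ := (h.integrable_step_pow_mul 1 hmeas₁
    (integrable_norm_sq_mul_inner he hg)).const_mul 4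
  have hint₂ := (h.integrable_step_pow_mul 2 hmeas₂
    (integrable_norm_sq_mul_norm_sq he hg)).const_mul 8
  have hint₄ := (h.integrable_step_pow_mul 4 hmeas₄
    (hg.integrable_norm_pow four_ne_zero)).const_mul 3
  have hmean := h.integral_step_pow_mul 1 hmeas₁
  simp only [pow_one] at hint₁ hmean
  refine (integral_mono ((h.memLp_update .rfl he hq hs).integrable_norm_pow four_ne_zero)
    (((he4.add hint₁).add hint₂).add hint₄)
    fun ω => norm_add_smul_pow_four_le (e ω) (q ω + s ω) (mu ω)).trans_eq ?_
  rw [integral_add' ((he4.add hint₁).add hint₂) hint₄, integral_add' (he4.add hint₁) hint₂,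
    integral_add' he4 hint₁, integral_const_mul, integral_const_mul, integral_const_mul, hmean,
    h.integral_step_pow_mul 2 hmeas₂, h.integral_step_pow_mul 4 hmeas₄]
  simp_rw [inner_add_right, mul_add]
  rw [integral_add heq hes, hnoise]
  ring

end IndependentStep

section Contraction

variable [IsFiniteMeasure P] {ν δ b c : ℝ}

theorem integral_norm_sq_update_le (h : StochStep F G P mu ub e q s)
    (hmono : ∀ ω, ⟪e ω, q ω⟫ ≤ -ν * ‖e ω‖ ^ 2) (hlip : ∀ ω, ‖q ω‖ ≤ δ * ‖e ω‖)
    (hs : ∫ ω, ‖s ω‖ ^ 2 ∂P ≤ b ^ 2 * ∫ ω, ‖e ω‖ ^ 2 ∂P + c) (hmean : 0 ≤ ∫ ω, mu ω ∂P) :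
    ∫ ω, ‖e ω + mu ω • (q ω + s ω)‖ ^ 2 ∂P
      ≤ (1 - 2 * ν * (∫ ω, mu ω ∂P) + (δ ^ 2 + b ^ 2) * ∫ ω, mu ω ^ 2 ∂P) * ∫ ω, ‖e ω‖ ^ 2 ∂P
        + (∫ ω, mu ω ^ 2 ∂P) * c := by
  have he := h.memLp_e.integrable_norm_pow two_ne_zero
  have hmean_sq : 0 ≤ ∫ ω, mu ω ^ 2 ∂P := integral_nonneg fun ω => sq_nonneg _
  have hcross : ∫ ω, ⟪e ω, q ω⟫ ∂P ≤ -ν * ∫ ω, ‖e ω‖ ^ 2 ∂P := by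
    rw [← integral_const_mul]
    exact integral_mono (integrable_inner_of_memLp_two h.memLp_e h.memLp_q) (he.const_mul _) hmono
  have hq : ∫ ω, ‖q ω‖ ^ 2 ∂P ≤ δ ^ 2 * ∫ ω, ‖e ω‖ ^ 2 ∂P := by
    rw [← integral_const_mul]
    refine integral_mono (h.memLp_q.integrable_norm_pow two_ne_zero) (he.const_mul _) fun ω => ?_
    simp only [← mul_pow]
    exact pow_le_pow_left₀ (norm_nonneg _) (hlip ω) 2
  rw [h.integral_norm_sq_update]
  linarith [mul_le_mul_of_nonneg_left hcross hmean,
    mul_le_mul_of_nonneg_left (add_le_add hq hs) hmean_sq]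

-- The mixed term `8 μ² ‖e‖² ‖q + s‖²` is absorbed by giving up a quarter of the drift `4 ν μ ‖e‖⁴`.
theorem integral_norm_pow_four_update_le_of_moments (h : StochStep F G P mu ub e q s)
    {ρ mubar mux : ℝ} (hν : 0 < ν)
    (hmono : ∀ ω, ⟪e ω, q ω⟫ ≤ -ν * ‖e ω‖ ^ 2) (hlip : ∀ ω, ‖q ω‖ ≤ δ * ‖e ω‖)
    (he : MemLp e 4 P) (hs : MemLp s 4 P)
    (hs_le : ∫ ω, ‖s ω‖ ^ 4 ∂P ≤ b ^ 4 * ∫ ω, ‖e ω‖ ^ 4 ∂P + c)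
    (hmean : ∫ ω, mu ω ∂P = mubar) (hmean_sq : ∫ ω, mu ω ^ 2 ∂P = mubar * mux)
    (hmean_four : ∫ ω, mu ω ^ 4 ∂P ≤ ρ * mubar * mux ^ 2) (hmubar : 0 ≤ mubar) (hρ : 0 ≤ ρ) :
    ∫ ω, ‖e ω + mu ω • (q ω + s ω)‖ ^ 4 ∂P ≤ (1 - 3 * ν * mubar) * ∫ ω, ‖e ω‖ ^ 4 ∂P
      + mubar * mux ^ 2 * (16 / ν + 3 * ρ)
        * (8 * ((δ ^ 4 + b ^ 4) * ∫ ω, ‖e ω‖ ^ 4 ∂P + c)) := by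
  have he4 := he.integrable_norm_pow four_ne_zero
  have hq : MemLp q 4 P := he.of_le_mul (h.meas_q.mono h.past_le).aestronglyMeasurable
    (ae_of_all _ hlip)
  have hq_le : ∫ ω, ‖q ω‖ ^ 4 ∂P ≤ δ ^ 4 * ∫ ω, ‖e ω‖ ^ 4 ∂P := by
    rw [← integral_const_mul]
    refine integral_mono (hq.integrable_norm_pow four_ne_zero) (he4.const_mul _) fun ω => ?_
    simp only [← mul_pow]
    exact pow_le_pow_left₀ (norm_nonneg _) (hlip ω) 4
  have hgrad : ∫ ω, ‖q ω + s ω‖ ^ 4 ∂P ≤ 8 * ((δ ^ 4 + b ^ 4) * ∫ ω, ‖e ω‖ ^ 4 ∂P + c) :=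
    (integral_norm_add_pow_four_le hq hs).trans (by linarith)
  have hcross : ∫ ω, ‖e ω‖ ^ 2 * ⟪e ω, q ω⟫ ∂P ≤ -ν * ∫ ω, ‖e ω‖ ^ 4 ∂P := by
    rw [← integral_const_mul]
    refine integral_mono (integrable_norm_sq_mul_inner he hq) (he4.const_mul _) fun ω => ?_
    exact (mul_le_mul_of_nonneg_left (hmono ω) (sq_nonneg ‖e ω‖)).trans_eq (by ring)
  have hmixed := mul_integral_norm_sq_mul_norm_sq_le he (hq.add hs) hν mux
  refine (h.integral_norm_pow_four_update_le he hq hs).trans ?_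
  rw [hmean, hmean_sq]
  have hgrad_nonneg : 0 ≤ ∫ ω, ‖q ω + s ω‖ ^ 4 ∂P := integral_nonneg fun ω => by positivity
  have hcoeff : 0 ≤ mubar * mux ^ 2 * (16 / ν + 3 * ρ) := by positivity
  simp only [Pi.add_apply] at hmixed
  linarith [mul_le_mul_of_nonneg_left hcross hmubar, mul_le_mul_of_nonneg_left hmixed hmubar,
    mul_le_mul_of_nonneg_right hmean_four hgrad_nonneg, mul_le_mul_of_nonneg_left hgrad hcoeff]

theorem setIntegral_norm_sq_update_le (h : StochStep F G P mu ub e q s)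
    (hB : MeasurableSet[F] B)
    (hmono : ∀ ω, ⟪e ω, q ω⟫ ≤ -ν * ‖e ω‖ ^ 2) (hlip : ∀ ω, ‖q ω‖ ≤ δ * ‖e ω‖)
    (hs : ∫ ω in B, ‖s ω‖ ^ 2 ∂P ≤ b ^ 2 * ∫ ω in B, ‖e ω‖ ^ 2 ∂P + c)
    (hmean : 0 ≤ ∫ ω, mu ω ∂P) :
    ∫ ω in B, ‖e ω + mu ω • (q ω + s ω)‖ ^ 2 ∂P
      ≤ (1 - 2 * ν * (∫ ω, mu ω ∂P) + (δ ^ 2 + b ^ 2) * ∫ ω, mu ω ^ 2 ∂P)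
          * ∫ ω in B, ‖e ω‖ ^ 2 ∂P
        + (∫ ω, mu ω ^ 2 ∂P) * c := by
  have hBm := h.past_le _ hB
  rw [← integral_norm_indicator_pow hBm two_ne_zero, ← integral_norm_indicator_pow hBm two_ne_zero]
    at hs ⊢
  simpa only [indicator_add_smul_indicator_add] using (h.indicator hB).integral_norm_sq_update_le
    (inner_indicator_le hmono B) (norm_indicator_le_mul_norm_indicator hlip B) hs hmean

theorem setIntegral_norm_pow_four_update_le (h : StochStep F G P mu ub e q s)
    (hB : MeasurableSet[F] B) {ρ mubar mux : ℝ} (hν : 0 < ν)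
    (hmono : ∀ ω, ⟪e ω, q ω⟫ ≤ -ν * ‖e ω‖ ^ 2) (hlip : ∀ ω, ‖q ω‖ ≤ δ * ‖e ω‖)
    (he : MemLp e 4 (P.restrict B)) (hs : MemLp s 4 (P.restrict B))
    (hs_le : ∫ ω in B, ‖s ω‖ ^ 4 ∂P ≤ b ^ 4 * ∫ ω in B, ‖e ω‖ ^ 4 ∂P + c)
    (hmean : ∫ ω, mu ω ∂P = mubar) (hmean_sq : ∫ ω, mu ω ^ 2 ∂P = mubar * mux)
    (hmean_four : ∫ ω, mu ω ^ 4 ∂P ≤ ρ * mubar * mux ^ 2) (hmubar : 0 ≤ mubar) (hρ : 0 ≤ ρ) :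
    ∫ ω in B, ‖e ω + mu ω • (q ω + s ω)‖ ^ 4 ∂P
      ≤ (1 - 3 * ν * mubar) * ∫ ω in B, ‖e ω‖ ^ 4 ∂P
        + mubar * mux ^ 2 * (16 / ν + 3 * ρ)
          * (8 * ((δ ^ 4 + b ^ 4) * ∫ ω in B, ‖e ω‖ ^ 4 ∂P + c)) := by
  have hBm := h.past_le _ hB
  rw [← integral_norm_indicator_pow hBm four_ne_zero,
    ← integral_norm_indicator_pow hBm four_ne_zero] at hs_le ⊢
  simpa only [indicator_add_smul_indicator_add] using
    (h.indicator hB).integral_norm_pow_four_update_le_of_moments hν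
      (inner_indicator_le hmono B) (norm_indicator_le_mul_norm_indicator hlip B)
      ((memLp_indicator_iff_restrict hBm).mpr he) ((memLp_indicator_iff_restrict hBm).mpr hs)
      hs_le hmean hmean_sq hmean_four hmubar hρ

end Contraction

end StochStep

/-! ### Mean-square recursion -/

section StepSizeParameters

variable {ν δ β μbar σμ : ℝ}

theorem muX_pos (hμ : 0 < μbar) : 0 < muX μbar σμ := by
  unfold muX
  positivity

theorem mul_muX (hμ : 0 < μbar) : μbar * muX μbar σμ = μbar ^ 2 + σμ ^ 2 := by
  unfold muX
  field_simp

theorem le_muX (hμ : 0 < μbar) : μbar ≤ muX μbar σμ :=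
  le_add_of_nonneg_right (by positivity)

theorem alphaAsyn_nonneg (hν : 0 ≤ ν) (hle : ν ≤ δ) : 0 ≤ alphaAsyn ν δ β μbar σμ := by
  have hsq : ν ^ 2 * μbar ^ 2 ≤ (δ ^ 2 + β ^ 2) * (μbar ^ 2 + σμ ^ 2) := by
    gcongr
    · nlinarith [sq_nonneg β]
    · exact le_add_of_nonneg_right (sq_nonneg σμ)
  unfold alphaAsyn
  linarith [sq_nonneg (1 - ν * μbar)]

theorem alphaAsyn_lt_one (hδ : 0 < δ) (hμ : 0 < μbar)
    (h : muX μbar σμ < 2 * ν / (δ ^ 2 + β ^ 2)) : alphaAsyn ν δ β μbar σμ < 1 := by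
  rw [lt_div_iff₀ (by positivity)] at h
  unfold alphaAsyn
  rw [← mul_muX hμ]
  linarith [mul_lt_mul_of_pos_left h hμ]

theorem abs_alphaAsyn_sub_le (hμ : 0 < μbar) :
    |alphaAsyn ν δ β μbar σμ - (1 - 2 * ν * μbar)| ≤ (δ ^ 2 + β ^ 2) * muX μbar σμ ^ 2 := by
  have hx := muX_pos (σμ := σμ) hμ
  unfold alphaAsyn
  rw [add_sub_cancel_left, ← mul_muX hμ, abs_of_nonneg (by positivity), sq (muX μbar σμ)]
  gcongr
  exact le_muX hμ

end StepSizeParameters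

theorem exists_measurableSet_measureReal_le_and_memLp_top {Ω E : Type*} {F : MeasurableSpace Ω}
    [m : MeasurableSpace Ω] [NormedAddCommGroup E] [MeasurableSpace E] [OpensMeasurableSpace E]
    [SecondCountableTopology E] {P : Measure Ω} {f : Ω → E} (hF : F ≤ m) (hf : Measurable[F] f)
    (hfi : Integrable f P) {t : ℝ} (ht : 0 < t) :
    ∃ D, MeasurableSet[F] D ∧ P.real D ≤ t ∧ MemLp f ∞ (P.restrict Dᶜ) := by
  set ε := (∫ ω, ‖f ω‖ ∂P + 1) / t with hε
  have hI : 0 ≤ ∫ ω, ‖f ω‖ ∂P := integral_nonneg fun ω => norm_nonneg _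
  have hε_pos : 0 < ε := div_pos (add_pos_of_nonneg_of_pos hI one_pos) ht
  have hD : MeasurableSet[F] {ω | ε ≤ ‖f ω‖} :=
    hf (measurableSet_le measurable_const measurable_norm)
  refine ⟨{ω | ε ≤ ‖f ω‖}, hD, ?_, ?_⟩
  · have hmarkov : ε * P.real {ω | ε ≤ ‖f ω‖} ≤ ∫ ω, ‖f ω‖ ∂P :=
      mul_meas_ge_le_integral_of_nonneg (ae_of_all _ fun ω => norm_nonneg _) hfi.norm ε
    have hεt : ε * t = ∫ ω, ‖f ω‖ ∂P + 1 := by rw [hε]; field_simp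
    exact le_of_mul_le_mul_left (by linarith) hε_pos
  · refine memLp_top_of_bound (hf.mono hF le_rfl).aestronglyMeasurable ε
      ((ae_restrict_iff' (hF _ hD.compl)).mpr (ae_of_all _ fun ω hω => ?_))
    exact (not_le.mp (Set.notMem_ofPred_iff.mp hω)).le

theorem pow_three_le_pow_four_div_add {t : ℝ} (ht : 0 < t) (x : ℝ) :
    x ^ 3 ≤ x ^ 4 / t + t * x ^ 2 := by
  have h : x ^ 4 / t + t * x ^ 2 - x ^ 3
      = ((x ^ 2 - t * x / 2) ^ 2 + 3 / 4 * (t * x) ^ 2) / t := by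
    field_simp
    ring
  exact sub_nonneg.mp (h ▸ by positivity)

namespace AsyncSGD

section Measurability

variable {Ω : Type*} [m : MeasurableSpace Ω] {M : ℕ} (A : AsyncSGD Ω M)

/-- The σ-algebra of everything that determines the `i`-th update, except the step-size. -/
abbrev known (i : ℕ) : MeasurableSpace Ω :=
  A.past i ⊔ ⨆ j : Fin (i + 1),
    MeasurableSpace.comap (fun ω => A.ghat j (A.iter j ω) ω) inferInstance

theorem measurable_ghat_comp (i : ℕ) {W : Ω → EuclideanSpace ℝ (Fin M)} (hW : Measurable W) :
    Measurable fun ω => A.ghat i (W ω) ω :=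
  (A.measurable_ghat i).comp (hW.prodMk measurable_id)

theorem measurable_iter (i : ℕ) : Measurable (A.iter i) := by
  induction i with
  | zero => exact A.measurable_init
  | succ i ih => exact ih.sub ((A.measurable_step i).smul (A.measurable_ghat_comp i ih))

theorem past_le (i : ℕ) : A.past i ≤ m :=
  iSup_le fun j => (A.measurable_iter j).comap_le

theorem known_le (i : ℕ) : A.known i ≤ m :=
  sup_le (A.past_le i)
    (iSup_le fun j => (A.measurable_ghat_comp j (A.measurable_iter j)).comap_le)

theorem measurable_iter_past {i j : ℕ} (hj : j ≤ i) : Measurable[A.past i] (A.iter j) :=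
  Measurable.of_comap_le <|
    le_iSup (fun k : Fin (i + 1) => MeasurableSpace.comap (A.iter k) inferInstance)
      ⟨j, Nat.lt_succ_of_le hj⟩

theorem past_zero_le (i : ℕ) : A.past 0 ≤ A.past i :=
  iSup_le fun j => (A.measurable_iter_past (Fin.is_le j |>.trans i.zero_le)).comap_le

theorem measurable_ghat_known (i : ℕ) :
    Measurable[A.known i] fun ω => A.ghat i (A.iter i ω) ω :=
  Measurable.of_comap_le <|
    (le_iSup (fun j : Fin (i + 1) => MeasurableSpace.comap (fun ω => A.ghat j (A.iter j ω) ω)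
      inferInstance) (Fin.last i)).trans le_sup_right

theorem measurable_err_past (wo : EuclideanSpace ℝ (Fin M)) (i : ℕ) :
    Measurable[A.past i] (A.err wo i) :=
  (measurable_id.const_sub wo).comp (A.measurable_iter_past le_rfl)

theorem measurable_err (wo : EuclideanSpace ℝ (Fin M)) (i : ℕ) : Measurable (A.err wo i) :=
  (A.measurable_err_past wo i).mono (A.past_le i) le_rfl

variable {J : EuclideanSpace ℝ (Fin M) → ℝ}

theorem measurable_noise (hJ : Measurable (gradient J)) (i : ℕ)
    {W : Ω → EuclideanSpace ℝ (Fin M)} (hW : Measurable W) :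
    Measurable fun ω => A.noise J i (W ω) ω :=
  (A.measurable_ghat_comp i hW).sub (hJ.comp hW)

theorem measurable_noise_iter (hJ : Measurable (gradient J)) (i : ℕ) :
    Measurable fun ω => A.noise J i (A.iter i ω) ω :=
  A.measurable_noise hJ i (A.measurable_iter i)

theorem measurable_gradient_past (hJ : Measurable (gradient J)) (i : ℕ) :
    Measurable[A.past i] fun ω => gradient J (A.iter i ω) :=
  hJ.comp (A.measurable_iter_past le_rfl)

theorem err_succ (J : EuclideanSpace ℝ (Fin M) → ℝ) (wo : EuclideanSpace ℝ (Fin M)) (i : ℕ)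
    (ω : Ω) :
    A.err wo (i + 1) ω = A.err wo i ω
      + A.step i ω • (gradient J (A.iter i ω) + A.noise J i (A.iter i ω) ω) := by
  simp only [err, iter, noise]
  rw [add_sub_cancel]
  abel

end Measurability

variable {Ω : Type*} [m : MeasurableSpace Ω] {M : ℕ} {A : AsyncSGD Ω M} {P : Measure Ω}
  {J : EuclideanSpace ℝ (Fin M) → ℝ} {wo : EuclideanSpace ℝ (Fin M)}
  {ν δ β σs β₄ σ₄ ρ μub μbar σμ t : ℝ} {Rs : Matrix (Fin M) (Fin M) ℝ} {B : Set Ω}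

theorem norm_gradient_iter_le (hJ : CostConditions J wo ν δ) (i : ℕ) (ω : Ω) :
    ‖gradient J (A.iter i ω)‖ ≤ δ * ‖A.err wo i ω‖ := by
  rw [err, norm_sub_rev]
  exact hJ.norm_gradient_le _

theorem inner_err_gradient_le (hJ : CostConditions J wo ν δ) (i : ℕ) (ω : Ω) :
    ⟪A.err wo i ω, gradient J (A.iter i ω)⟫ ≤ -ν * ‖A.err wo i ω‖ ^ 2 := by
  have h := hJ.mul_norm_sq_le_inner_gradient (A.iter i ω)
  rw [err, ← neg_sub (A.iter i ω) wo, inner_neg_left, norm_neg]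
  linarith

theorem StepConditions.integral_step_sq [IsProbabilityMeasure P]
    (hS : A.StepConditions P μub μbar σμ) (i : ℕ) :
    ∫ ω, A.step i ω ^ 2 ∂P = μbar * muX μbar σμ := by
  have hstep : MemLp (A.step i) 2 P := by
    refine MemLp.of_bound (A.measurable_step i).aestronglyMeasurable μub ?_
    filter_upwards [hS.mem_Icc i] with ω hω
    rw [Real.norm_eq_abs, abs_of_nonneg hω.1]
    exact hω.2
  have hvar := variance_eq_sub hstep
  rw [variance_eq_integral hstep.aemeasurable, hS.mean i, hS.variance i] at hvar
  rw [mul_muX hS.mean_pos, hvar]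
  simp

theorem NoiseConditions.setIntegral_norm_noise_sq_le [IsProbabilityMeasure P]
    (hN : A.NoiseConditions P J wo β σs Rs) (hJ : Measurable (gradient J)) (i : ℕ)
    (he : MemLp (A.err wo i) 2 P) (hB : MeasurableSet[A.past i] B) :
    ∫ ω in B, ‖A.noise J i (A.iter i ω) ω‖ ^ 2 ∂P
      ≤ β ^ 2 * ∫ ω in B, ‖A.err wo i ω‖ ^ 2 ∂P + P.real B * σs ^ 2 := by
  have he_sq := (he.integrable_norm_pow two_ne_zero).const_mul (β ^ 2)
  refine (setIntegral_norm_pow_le_of_condLExp_le (A.past_le i)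
    (A.measurable_noise_iter hJ i).aestronglyMeasurable (fun ω => by positivity)
    (hN.second_moment i) hB (he_sq.add (integrable_const _)).integrableOn).trans_eq ?_
  rw [integral_add he_sq.integrableOn (integrable_const _), integral_const_mul, setIntegral_const,
    smul_eq_mul]

theorem NoiseConditions.memLp_noise [IsProbabilityMeasure P]
    (hN : A.NoiseConditions P J wo β σs Rs) (hJ : Measurable (gradient J)) (i : ℕ)
    (he : MemLp (A.err wo i) 2 P) : MemLp (fun ω => A.noise J i (A.iter i ω) ω) 2 P := by
  have he_sq := (he.integrable_norm_pow two_ne_zero).const_mul (β ^ 2)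
  simpa using memLp_restrict_of_condLExp_le (A.past_le i)
    (A.measurable_noise_iter hJ i).aestronglyMeasurable two_ne_zero (fun ω => by positivity)
    (hN.second_moment i) MeasurableSet.univ (he_sq.add (integrable_const _)).integrableOn

theorem FourthMomentConditions.memLp_noise [IsProbabilityMeasure P]
    (h₄ : A.FourthMomentConditions P J wo β₄ σ₄ ρ μbar σμ) (hJ : Measurable (gradient J)) (i : ℕ)
    (hB : MeasurableSet[A.past i] B) (he : MemLp (A.err wo i) 4 (P.restrict B)) :
    MemLp (fun ω => A.noise J i (A.iter i ω) ω) 4 (P.restrict B) := by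
  have he_four := (he.integrable_norm_pow four_ne_zero).const_mul (β₄ ^ 4)
  exact memLp_restrict_of_condLExp_le (A.past_le i)
    (A.measurable_noise_iter hJ i).aestronglyMeasurable four_ne_zero (fun ω => by positivity)
    (h₄.noise_le i) hB (he_four.add (integrable_const _))

theorem FourthMomentConditions.setIntegral_norm_noise_pow_four_le [IsProbabilityMeasure P]
    (h₄ : A.FourthMomentConditions P J wo β₄ σ₄ ρ μbar σμ) (hJ : Measurable (gradient J)) (i : ℕ)
    (hB : MeasurableSet[A.past i] B) (he : MemLp (A.err wo i) 4 (P.restrict B)) :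
    ∫ ω in B, ‖A.noise J i (A.iter i ω) ω‖ ^ 4 ∂P
      ≤ β₄ ^ 4 * ∫ ω in B, ‖A.err wo i ω‖ ^ 4 ∂P + σ₄ ^ 4 := by
  have he_four := (he.integrable_norm_pow four_ne_zero).const_mul (β₄ ^ 4)
  refine (setIntegral_norm_pow_le_of_condLExp_le (A.past_le i)
    (A.measurable_noise_iter hJ i).aestronglyMeasurable (fun ω => by positivity)
    (h₄.noise_le i) hB (he_four.add (integrable_const _))).trans ?_
  rw [integral_add he_four (integrable_const _), integral_const_mul, setIntegral_const,
    smul_eq_mul]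
  gcongr
  exact mul_le_of_le_one_left (by positivity) measureReal_le_one

theorem stochStep_of_memLp [IsProbabilityMeasure P] (hJ : CostConditions J wo ν δ)
    (hN : A.NoiseConditions P J wo β σs Rs) (hS : A.StepConditions P μub μbar σμ) (i : ℕ)
    (he : MemLp (A.err wo i) 2 P) :
    StochStep (A.past i) (A.known i) P (A.step i) μub (A.err wo i)
      (fun ω => gradient J (A.iter i ω)) (fun ω => A.noise J i (A.iter i ω) ω) :=
  have hgrad := A.measurable_gradient_past hJ.measurable_gradient i
  { le := le_sup_left
    le_ambient := A.known_le i
    meas_e := (A.measurable_err_past wo i).stronglyMeasurable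
    meas_q := hgrad.stronglyMeasurable
    meas_s := ((A.measurable_ghat_known i).sub
      (hgrad.mono le_sup_left le_rfl)).stronglyMeasurable
    meas_mu := A.measurable_step i
    mem_Icc := hS.mem_Icc i
    indep := hS.indep i
    memLp_e := he
    memLp_q := he.of_le_mul (hgrad.mono (A.past_le i) le_rfl).aestronglyMeasurable
      (ae_of_all _ fun ω => norm_gradient_iter_le hJ i ω)
    memLp_s := hN.memLp_noise hJ.measurable_gradient i he
    mean_zero := hN.mean_zero i }

/-- The assumptions on the cost, the initial point, the gradient noise and the step-sizes that are
in force throughout the analysis of the algorithm. -/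
structure StandingConditions (A : AsyncSGD Ω M) (P : Measure Ω)
    (J : EuclideanSpace ℝ (Fin M) → ℝ) (wo : EuclideanSpace ℝ (Fin M))
    (ν δ β σs : ℝ) (Rs : Matrix (Fin M) (Fin M) ℝ) (μub μbar σμ : ℝ) : Prop where
  cost : CostConditions J wo ν δ
  memLp_init : MemLp A.init 2 P
  noise : A.NoiseConditions P J wo β σs Rs
  step : A.StepConditions P μub μbar σμ

namespace StandingConditions

variable [IsProbabilityMeasure P]

theorem memLp_err (h : A.StandingConditions P J wo ν δ β σs Rs μub μbar σμ) (i : ℕ) :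
    MemLp (A.err wo i) 2 P := by
  induction i with
  | zero => exact (memLp_const wo).sub h.memLp_init
  | succ i ih =>
    have hstep := stochStep_of_memLp h.cost h.noise h.step i ih
    rw [funext (A.err_succ J wo i)]
    exact hstep.memLp_update .rfl hstep.memLp_e hstep.memLp_q hstep.memLp_s

theorem integrable_norm_err_sq (h : A.StandingConditions P J wo ν δ β σs Rs μub μbar σμ) (i : ℕ) :
    Integrable (fun ω => ‖A.err wo i ω‖ ^ 2) P :=
  (h.memLp_err i).integrable_norm_pow two_ne_zero

theorem stochStep (h : A.StandingConditions P J wo ν δ β σs Rs μub μbar σμ) (i : ℕ) :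
    StochStep (A.past i) (A.known i) P (A.step i) μub (A.err wo i)
      (fun ω => gradient J (A.iter i ω)) (fun ω => A.noise J i (A.iter i ω) ω) :=
  stochStep_of_memLp h.cost h.noise h.step i (h.memLp_err i)

theorem setIntegral_norm_err_sq_succ_le
    (h : A.StandingConditions P J wo ν δ β σs Rs μub μbar σμ) (i : ℕ)
    (hB : MeasurableSet[A.past i] B) :
    ∫ ω in B, ‖A.err wo (i + 1) ω‖ ^ 2 ∂P
      ≤ alphaAsyn ν δ β μbar σμ * ∫ ω in B, ‖A.err wo i ω‖ ^ 2 ∂P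
        + (μbar ^ 2 + σμ ^ 2) * (P.real B * σs ^ 2) := by
  have hrec := (h.stochStep i).setIntegral_norm_sq_update_le hB (inner_err_gradient_le h.cost i)
    (norm_gradient_iter_le h.cost i)
    (h.noise.setIntegral_norm_noise_sq_le h.cost.measurable_gradient i (h.memLp_err i) hB)
    (by rw [h.step.mean i]; exact h.step.mean_pos.le)
  rw [h.step.mean i, h.step.integral_step_sq, mul_muX h.step.mean_pos] at hrec
  simpa only [A.err_succ J wo i, alphaAsyn] using hrec

theorem integral_norm_err_sq_succ_le
    (h : A.StandingConditions P J wo ν δ β σs Rs μub μbar σμ) (i : ℕ) :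
    ∫ ω, ‖A.err wo (i + 1) ω‖ ^ 2 ∂P
      ≤ alphaAsyn ν δ β μbar σμ * ∫ ω, ‖A.err wo i ω‖ ^ 2 ∂P
        + (μbar ^ 2 + σμ ^ 2) * σs ^ 2 := by
  simpa using h.setIntegral_norm_err_sq_succ_le i MeasurableSet.univ

theorem memLp_four_err (h : A.StandingConditions P J wo ν δ β σs Rs μub μbar σμ)
    (h₄ : A.FourthMomentConditions P J wo β₄ σ₄ ρ μbar σμ) (hB : MeasurableSet[A.past 0] B)
    (he : MemLp (A.err wo 0) 4 (P.restrict B)) (i : ℕ) :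
    MemLp (A.err wo i) 4 (P.restrict B) := by
  induction i with
  | zero => exact he
  | succ i ih =>
    have hstep := h.stochStep i
    rw [funext (A.err_succ J wo i)]
    exact hstep.memLp_update Measure.restrict_le_self.absolutelyContinuous ih
      (ih.of_le_mul (hstep.meas_q.mono hstep.past_le).aestronglyMeasurable
        (ae_of_all _ (norm_gradient_iter_le h.cost i)))
      (h₄.memLp_noise h.cost.measurable_gradient i (A.past_zero_le i _ hB) ih)

theorem setIntegral_norm_err_pow_four_succ_le
    (h : A.StandingConditions P J wo ν δ β σs Rs μub μbar σμ)
    (h₄ : A.FourthMomentConditions P J wo β₄ σ₄ ρ μbar σμ) (i : ℕ)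
    (hB : MeasurableSet[A.past i] B) (he : MemLp (A.err wo i) 4 (P.restrict B)) :
    ∫ ω in B, ‖A.err wo (i + 1) ω‖ ^ 4 ∂P
      ≤ (1 - 3 * ν * μbar) * ∫ ω in B, ‖A.err wo i ω‖ ^ 4 ∂P
        + μbar * muX μbar σμ ^ 2 * (16 / ν + 3 * |ρ|)
          * (8 * ((δ ^ 4 + β₄ ^ 4) * ∫ ω in B, ‖A.err wo i ω‖ ^ 4 ∂P + σ₄ ^ 4)) := by
  have hmean := h.step.mean_pos
  have hstep_four : ∫ ω, A.step i ω ^ 4 ∂P ≤ |ρ| * μbar * muX μbar σμ ^ 2 :=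
    (h₄.step_le i).trans (by gcongr; exact le_abs_self ρ)
  simpa only [A.err_succ J wo i] using (h.stochStep i).setIntegral_norm_pow_four_update_le hB
    h.cost.pos (inner_err_gradient_le h.cost i) (norm_gradient_iter_le h.cost i) he
    (h₄.memLp_noise h.cost.measurable_gradient i hB he)
    (h₄.setIntegral_norm_noise_pow_four_le h.cost.measurable_gradient i hB he)
    (h.step.mean i) (h.step.integral_step_sq i) hstep_four hmean.le (abs_nonneg ρ)

end StandingConditions

end AsyncSGD

/-! ### Steady-state moment bounds -/

/-- The factor `K` in the asymptotic bound `E ‖err‖² ≤ K μ_x`. -/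
noncomputable def meanSquareConst (ν σs : ℝ) : ℝ := σs ^ 2 / ν + 1

/-- The factor `K₄` in the asymptotic bound `E ‖err‖⁴ ≤ K₄ μ_x²`. -/
noncomputable def meanFourthConst (ν σ₄ ρ : ℝ) : ℝ := 8 * (16 / ν + 3 * |ρ|) * σ₄ ^ 4 / ν + 1

/-- The factor `g` for which the perturbation of the fourth-moment recursion by the noise and the
higher-order terms is at most `g μbar μ_x² E ‖err‖⁴`. -/
noncomputable def fourthMomentGain (ν δ β₄ ρ : ℝ) : ℝ :=
  8 * (16 / ν + 3 * |ρ|) * (δ ^ 4 + β₄ ^ 4)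

theorem meanSquareConst_nonneg {ν σs : ℝ} (hν : 0 < ν) : 0 ≤ meanSquareConst ν σs := by
  unfold meanSquareConst
  positivity

theorem meanFourthConst_nonneg {ν σ₄ ρ : ℝ} (hν : 0 < ν) : 0 ≤ meanFourthConst ν σ₄ ρ := by
  unfold meanFourthConst
  positivity

namespace AsyncSGD.StandingConditions

variable {Ω : Type*} [MeasurableSpace Ω] {M : ℕ} {A : AsyncSGD Ω M} {P : Measure Ω}
  {J : EuclideanSpace ℝ (Fin M) → ℝ} {wo : EuclideanSpace ℝ (Fin M)}
  {ν δ β σs β₄ σ₄ ρ μub μbar σμ t : ℝ} {Rs : Matrix (Fin M) (Fin M) ℝ} {B : Set Ω}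

theorem mul_mean_le_one (h : A.StandingConditions P J wo ν δ β σs Rs μub μbar σμ)
    (hμ : muX μbar σμ * (δ ^ 2 + β ^ 2) ≤ ν) : ν * μbar ≤ 1 := by
  have hν := h.cost.pos
  have hx := le_muX (σμ := σμ) h.step.mean_pos
  have hle : ν ^ 2 ≤ δ ^ 2 + β ^ 2 := by nlinarith [h.cost.le, sq_nonneg β]
  refine le_of_mul_le_mul_left ?_ hν
  calc ν * (ν * μbar) = μbar * ν ^ 2 := by ring
    _ ≤ muX μbar σμ * (δ ^ 2 + β ^ 2) :=
      mul_le_mul hx hle (sq_nonneg ν) (h.step.mean_pos.le.trans hx)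
    _ ≤ ν * 1 := by rwa [mul_one]

variable [IsProbabilityMeasure P]

theorem eventually_setIntegral_norm_err_sq_le
    (h : A.StandingConditions P J wo ν δ β σs Rs μub μbar σμ)
    (hμ : muX μbar σμ * (δ ^ 2 + β ^ 2) ≤ ν) (hB : MeasurableSet[A.past 0] B) {p : ℝ}
    (hp : 0 < p) (hPB : P.real B ≤ p) :
    ∀ᶠ i in atTop, ∫ ω in B, ‖A.err wo i ω‖ ^ 2 ∂P
      ≤ meanSquareConst ν σs * p * muX μbar σμ := by
  have hν := h.cost.pos
  have hb := h.step.mean_pos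
  have hx := muX_pos (σμ := σμ) hb
  refine eventually_le_of_le_contraction (a := ν * μbar)
    (b := (μbar ^ 2 + σμ ^ 2) * (P.real B * σs ^ 2)) (by positivity) (h.mul_mean_le_one hμ) ?_
    (Eventually.of_forall fun i => ?_)
  · rw [← mul_muX hb, mul_assoc, mul_comm ν, mul_div_mul_left _ _ hb.ne']
    calc muX μbar σμ * (P.real B * σs ^ 2) / ν ≤ muX μbar σμ * (p * σs ^ 2) / ν := by gcongr
      _ < muX μbar σμ * (p * σs ^ 2) / ν + p * muX μbar σμ := lt_add_of_pos_right _ (by positivity)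
      _ = meanSquareConst ν σs * p * muX μbar σμ := by unfold meanSquareConst; ring
  · refine (h.setIntegral_norm_err_sq_succ_le i (A.past_zero_le i _ hB)).trans ?_
    gcongr
    unfold alphaAsyn
    rw [← mul_muX hb]
    linarith [mul_le_mul_of_nonneg_left hμ hb.le]

theorem eventually_integral_norm_err_sq_le
    (h : A.StandingConditions P J wo ν δ β σs Rs μub μbar σμ)
    (hμ : muX μbar σμ * (δ ^ 2 + β ^ 2) ≤ ν) :
    ∀ᶠ i in atTop, ∫ ω, ‖A.err wo i ω‖ ^ 2 ∂P ≤ meanSquareConst ν σs * muX μbar σμ := by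
  simpa using h.eventually_setIntegral_norm_err_sq_le hμ MeasurableSet.univ one_pos
    measureReal_le_one

theorem eventually_setIntegral_norm_err_pow_four_le
    (h : A.StandingConditions P J wo ν δ β σs Rs μub μbar σμ)
    (h₄ : A.FourthMomentConditions P J wo β₄ σ₄ ρ μbar σμ)
    (hμ : muX μbar σμ * (δ ^ 2 + β ^ 2) ≤ ν)
    (hμ₄ : muX μbar σμ ^ 2 * fourthMomentGain ν δ β₄ ρ ≤ ν)
    (hB : MeasurableSet[A.past 0] B) (he : MemLp (A.err wo 0) 4 (P.restrict B)) :
    ∀ᶠ i in atTop, ∫ ω in B, ‖A.err wo i ω‖ ^ 4 ∂P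
      ≤ meanFourthConst ν σ₄ ρ * muX μbar σμ ^ 2 := by
  have hν := h.cost.pos
  have hb := h.step.mean_pos
  have hx := muX_pos (σμ := σμ) hb
  refine eventually_le_of_le_contraction (a := ν * μbar)
    (b := μbar * muX μbar σμ ^ 2 * (16 / ν + 3 * |ρ|) * (8 * σ₄ ^ 4)) (by positivity)
    (h.mul_mean_le_one hμ) ?_ (Eventually.of_forall fun i => ?_)
  · have hdiv : μbar * muX μbar σμ ^ 2 * (16 / ν + 3 * |ρ|) * (8 * σ₄ ^ 4) / (ν * μbar)
        = (meanFourthConst ν σ₄ ρ - 1) * muX μbar σμ ^ 2 := by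
      unfold meanFourthConst
      field_simp
      ring
    rw [hdiv]
    gcongr
    exact sub_one_lt _
  · have hstep := h.setIntegral_norm_err_pow_four_succ_le h₄ i (A.past_zero_le i _ hB)
      (h.memLp_four_err h₄ hB he i)
    have hI : 0 ≤ μbar * ∫ ω in B, ‖A.err wo i ω‖ ^ 4 ∂P :=
      mul_nonneg hb.le (integral_nonneg fun ω => by positivity)
    have hgain := mul_le_mul_of_nonneg_right hμ₄ hI
    unfold fourthMomentGain at hgain
    linarith [mul_nonneg hν.le hI]

theorem integrable_min_norm_err (h : A.StandingConditions P J wo ν δ β σs Rs μub μbar σμ) (i : ℕ) :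
    Integrable (fun ω => min (‖A.err wo i ω‖ ^ 2) (‖A.err wo i ω‖ ^ 3)) P := by
  have hmeas := (A.measurable_err wo i).norm
  refine (h.integrable_norm_err_sq i).mono'
    ((hmeas.pow_const 2).min (hmeas.pow_const 3)).aestronglyMeasurable (ae_of_all _ fun ω => ?_)
  rw [Real.norm_eq_abs, abs_of_nonneg (by positivity)]
  exact min_le_left _ _

theorem integral_min_norm_err_le (h : A.StandingConditions P J wo ν δ β σs Rs μub μbar σμ) (i : ℕ)
    {D : Set Ω} (hD : MeasurableSet D) (he : MemLp (A.err wo i) 4 (P.restrict Dᶜ)) (ht : 0 < t) :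
    ∫ ω, min (‖A.err wo i ω‖ ^ 2) (‖A.err wo i ω‖ ^ 3) ∂P
      ≤ ∫ ω in D, ‖A.err wo i ω‖ ^ 2 ∂P
        + ((∫ ω in Dᶜ, ‖A.err wo i ω‖ ^ 4 ∂P) / t + t * ∫ ω, ‖A.err wo i ω‖ ^ 2 ∂P) := by
  have hmin := h.integrable_min_norm_err i
  have hsq := h.integrable_norm_err_sq i
  have hfour := (he.integrable_norm_pow four_ne_zero).div_const t
  rw [← integral_add_compl hD hmin]
  gcongr ?_ + ?_
  · exact integral_mono hmin.integrableOn hsq.integrableOn fun ω => min_le_left _ _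
  · calc ∫ ω in Dᶜ, min (‖A.err wo i ω‖ ^ 2) (‖A.err wo i ω‖ ^ 3) ∂P
        ≤ ∫ ω in Dᶜ, (‖A.err wo i ω‖ ^ 4 / t + t * ‖A.err wo i ω‖ ^ 2) ∂P :=
          integral_mono hmin.integrableOn (hfour.add (hsq.integrableOn.const_mul t)) fun ω =>
            (min_le_right _ _).trans (pow_three_le_pow_four_div_add ht _)
      _ = (∫ ω in Dᶜ, ‖A.err wo i ω‖ ^ 4 ∂P) / t + t * ∫ ω in Dᶜ, ‖A.err wo i ω‖ ^ 2 ∂P := by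
          rw [integral_add hfour (hsq.integrableOn.const_mul t), integral_div, integral_const_mul]
      _ ≤ (∫ ω in Dᶜ, ‖A.err wo i ω‖ ^ 4 ∂P) / t + t * ∫ ω, ‖A.err wo i ω‖ ^ 2 ∂P := by
          gcongr _ + t * ?_
          exact setIntegral_le_integral hsq (ae_of_all _ fun ω => sq_nonneg _)

/-- The initial error has no fourth moment. The recursions are therefore run separately on the
event `D` of probability `O(μ_x^{1/2})` where it is large, and on the complement of `D`. -/
theorem eventually_integral_min_norm_err_le
    (h : A.StandingConditions P J wo ν δ β σs Rs μub μbar σμ)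
    (h₄ : A.FourthMomentConditions P J wo β₄ σ₄ ρ μbar σμ)
    (hμ : muX μbar σμ * (δ ^ 2 + β ^ 2) ≤ ν)
    (hμ₄ : muX μbar σμ ^ 2 * fourthMomentGain ν δ β₄ ρ ≤ ν)
    (ht : 0 < t) (hμt : muX μbar σμ = t ^ 2) :
    ∀ᶠ i in atTop, ∫ ω, min (‖A.err wo i ω‖ ^ 2) (‖A.err wo i ω‖ ^ 3) ∂P
      ≤ (meanFourthConst ν σ₄ ρ + 2 * meanSquareConst ν σs) * t ^ 3 := by
  obtain ⟨D, hD, hPD, htop⟩ := exists_measurableSet_measureReal_le_and_memLp_top (A.past_le 0)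
    (A.measurable_err_past wo 0) ((h.memLp_err 0).integrable one_le_two) ht
  have hfour := htop.mono_exponent (p := 4) le_top
  filter_upwards [h.eventually_setIntegral_norm_err_pow_four_le h₄ hμ hμ₄ hD.compl hfour,
    h.eventually_setIntegral_norm_err_sq_le hμ hD ht hPD,
    h.eventually_integral_norm_err_sq_le hμ] with i hcompl_four hD_sq hsq
  rw [hμt] at hcompl_four hD_sq hsq
  refine (h.integral_min_norm_err_le i (A.past_le 0 _ hD)
    (h.memLp_four_err h₄ hD.compl hfour i) ht).trans ?_
  calc _ ≤ meanSquareConst ν σs * t * t ^ 2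
        + (meanFourthConst ν σ₄ ρ * (t ^ 2) ^ 2 / t + t * (meanSquareConst ν σs * t ^ 2)) := by
        gcongr
    _ = (meanFourthConst ν σ₄ ρ + 2 * meanSquareConst ν σs) * t ^ 3 := by
        field_simp
        ring

end AsyncSGD.StandingConditions

/-! ### Steady-state covariance of the gradient noise -/

theorem rpow_le_add_sq {x κ : ℝ} (hx : 0 ≤ x) (hκ : κ ∈ Set.Icc (1 : ℝ) 2) :
    x ^ κ ≤ x + x ^ 2 := by
  rcases hx.eq_or_lt with rfl | hx_pos
  · simp [Real.zero_rpow (zero_lt_one.trans_le hκ.1).ne']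
  rcases le_total x 1 with hx1 | hx1
  · calc x ^ κ ≤ x ^ (1 : ℝ) := Real.rpow_le_rpow_of_exponent_ge hx_pos hx1 hκ.1
      _ = x := Real.rpow_one x
      _ ≤ x + x ^ 2 := le_add_of_nonneg_right (sq_nonneg x)
  · calc x ^ κ ≤ x ^ (2 : ℝ) := Real.rpow_le_rpow_of_exponent_le hx1 hκ.2
      _ = x ^ 2 := Real.rpow_two x
      _ ≤ x + x ^ 2 := le_add_of_nonneg_left hx

theorem inner_sq_le_mul_norm_sq {E : Type*} [NormedAddCommGroup E] [InnerProductSpace ℝ E]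
    (u x : E) : ⟪u, x⟫ ^ 2 ≤ ‖u‖ ^ 2 * ‖x‖ ^ 2 := by
  rw [← mul_pow]
  exact sq_le_sq.mpr ((abs_real_inner_le_norm u x).trans (le_abs_self _))

theorem integrable_inner_sq {Ω E : Type*} [MeasurableSpace Ω] [NormedAddCommGroup E]
    [InnerProductSpace ℝ E] {P : Measure Ω} {f : Ω → E} (hf : MemLp f 2 P) (u : E) :
    Integrable (fun ω => ⟪u, f ω⟫ ^ 2) P :=
  ((innerSL ℝ u).comp_memLp' hf).integrable_sq

namespace AsyncSGD

variable {Ω : Type*} [m : MeasurableSpace Ω] {M : ℕ} {A : AsyncSGD Ω M} {P : Measure Ω}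
  {J : EuclideanSpace ℝ (Fin M) → ℝ} {wo u : EuclideanSpace ℝ (Fin M)}
  {ν δ β σs τ₂ κ r μub μbar σμ : ℝ} {Rs : Matrix (Fin M) (Fin M) ℝ} {i : ℕ}

theorem inner_sq_eq_sum (u x : EuclideanSpace ℝ (Fin M)) :
    ⟪u, x⟫ ^ 2 = ∑ p : Fin M × Fin M, (u p.1 * u p.2) * (x p.1 * x p.2) := by
  simp only [PiLp.inner_apply, sq, Finset.sum_mul_sum, Fintype.sum_prod_type]
  refine Finset.sum_congr rfl fun k _ => Finset.sum_congr rfl fun l _ => ?_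
  simp only [RCLike.inner_apply, conj_trivial]
  ring

theorem quadForm_condCov {W : Ω → EuclideanSpace ℝ (Fin M)}
    (hW : MemLp (fun ω => A.noise J i (W ω) ω) 2 P) (u : EuclideanSpace ℝ (Fin M)) :
    (fun ω => quadForm (A.condCov P J i W ω) u)
      =ᵐ[P] P[fun ω => ⟪u, A.noise J i (W ω) ω⟫ ^ 2 | A.past i] := by
  have hcoord : ∀ k, MemLp (fun ω => A.noise J i (W ω) ω k) 2 P := fun k =>
    (EuclideanSpace.proj (𝕜 := ℝ) k).comp_memLp' hW
  let f : Fin M × Fin M → Ω → ℝ := fun p =>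
    (u p.1 * u p.2) • fun ω => A.noise J i (W ω) ω p.1 * A.noise J i (W ω) ω p.2
  have hsum : (fun ω => ⟪u, A.noise J i (W ω) ω⟫ ^ 2) = ∑ p, f p := by
    ext ω
    simp [f, inner_sq_eq_sum]
  have hf : ∀ p ∈ Finset.univ, Integrable (f p) P := fun p _ =>
    ((hcoord p.1).integrable_mul (hcoord p.2)).smul _
  have hterm : ∀ᵐ ω ∂P, ∀ p : Fin M × Fin M,
      P[f p | A.past i] ω = (u p.1 * u p.2) * A.condCov P J i W ω p.1 p.2 :=
    ae_all_iff.mpr fun p => condExp_smul _ _ _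
  rw [hsum]
  filter_upwards [condExp_finsetSum hf (A.past i), hterm] with ω hω_sum hω_term
  rw [hω_sum, Finset.sum_apply, quadForm_eq_sum, Fintype.sum_prod_type]
  refine Finset.sum_congr rfl fun k _ => Finset.sum_congr rfl fun l _ => ?_
  rw [hω_term]
  ring

theorem integrable_quadForm_condCov {W : Ω → EuclideanSpace ℝ (Fin M)}
    (hW : MemLp (fun ω => A.noise J i (W ω) ω) 2 P) (u : EuclideanSpace ℝ (Fin M)) :
    Integrable (fun ω => quadForm (A.condCov P J i W ω) u) P :=
  integrable_condExp.congr (quadForm_condCov hW u).symm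

theorem CovLipschitzAt.abs_quadForm_sub_le (hL : A.CovLipschitzAt P J wo τ₂ κ r)
    (hκ : κ ∈ Set.Icc (1 : ℝ) 2) (hτ₂ : 0 ≤ τ₂) {dw : Ω → EuclideanSpace ℝ (Fin M)}
    (hdw : Measurable[A.past i] dw) (hr : ∀ ω, ‖dw ω‖ ≤ r)
    (hdw_noise : MemLp (fun ω => A.noise J i (wo + dw ω) ω) 2 P) (hu : ‖u‖ = 1) :
    ∀ᵐ ω ∂P, |quadForm (A.condCov P J i (fun ω' => wo + dw ω') ω) u
        - quadForm (A.condCov P J i (fun _ => wo) ω) u| ≤ τ₂ * (‖dw ω‖ + ‖dw ω‖ ^ 2) := by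
  filter_upwards [hL i dw hdw hr hdw_noise] with ω hω
  rw [← quadForm_sub]
  refine (abs_quadForm_le _ u).trans ?_
  rw [hu, one_pow, mul_one]
  exact hω.trans (mul_le_mul_of_nonneg_left (rpow_le_add_sq (norm_nonneg _) hκ) hτ₂)

/-- The event that the iterate lies within distance `r` of the minimizer, so that the local
smoothness of the noise covariance applies to it. -/
def nearEvent (A : AsyncSGD Ω M) (wo : EuclideanSpace ℝ (Fin M)) (r : ℝ) (i : ℕ) : Set Ω :=
  {ω | ‖A.err wo i ω‖ ≤ r}

/-- The displacement from the minimizer to the iterate, truncated to zero when the iterate is at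
distance more than `r`: an admissible perturbation in `CovLipschitzAt`. -/
noncomputable def truncDisp (A : AsyncSGD Ω M) (wo : EuclideanSpace ℝ (Fin M)) (r : ℝ) (i : ℕ) :
    Ω → EuclideanSpace ℝ (Fin M) :=
  (A.nearEvent wo r i).indicator fun ω => -A.err wo i ω

theorem measurableSet_nearEvent (A : AsyncSGD Ω M) (wo : EuclideanSpace ℝ (Fin M)) (r : ℝ)
    (i : ℕ) : MeasurableSet[A.past i] (A.nearEvent wo r i) :=
  A.measurable_err_past wo i (measurableSet_le measurable_norm measurable_const)

theorem measurable_truncDisp (A : AsyncSGD Ω M) (wo : EuclideanSpace ℝ (Fin M)) (r : ℝ) (i : ℕ) :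
    Measurable[A.past i] (A.truncDisp wo r i) :=
  Measurable.indicator (measurable_neg.comp (A.measurable_err_past wo i))
    (A.measurableSet_nearEvent wo r i)

theorem norm_truncDisp_le (A : AsyncSGD Ω M) (wo : EuclideanSpace ℝ (Fin M)) (hr : 0 ≤ r) (i : ℕ)
    (ω : Ω) : ‖A.truncDisp wo r i ω‖ ≤ r := by
  by_cases hω : ω ∈ A.nearEvent wo r i
  · rw [truncDisp, Set.indicator_of_mem hω, norm_neg]
    exact hω
  · rwa [truncDisp, Set.indicator_of_notMem hω, norm_zero]

theorem norm_truncDisp_le_norm_err (A : AsyncSGD Ω M) (wo : EuclideanSpace ℝ (Fin M)) (r : ℝ)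
    (i : ℕ) (ω : Ω) : ‖A.truncDisp wo r i ω‖ ≤ ‖A.err wo i ω‖ :=
  (norm_indicator_le_norm_self _ _).trans_eq (norm_neg _)

theorem noise_truncDisp_of_mem {ω : Ω} (hω : ω ∈ A.nearEvent wo r i) :
    A.noise J i (wo + A.truncDisp wo r i ω) ω = A.noise J i (A.iter i ω) ω := by
  rw [truncDisp, Set.indicator_of_mem hω, err, neg_sub, add_sub_cancel]

theorem noise_truncDisp_of_notMem {ω : Ω} (hω : ω ∉ A.nearEvent wo r i) :
    A.noise J i (wo + A.truncDisp wo r i ω) ω = A.noise J i wo ω := by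
  rw [truncDisp, Set.indicator_of_notMem hω, add_zero]

theorem measureReal_compl_nearEvent_le [IsFiniteMeasure P] (he : MemLp (A.err wo i) 2 P)
    (hr : 0 < r) :
    P.real (A.nearEvent wo r i)ᶜ ≤ (∫ ω, ‖A.err wo i ω‖ ^ 2 ∂P) / r ^ 2 := by
  have hsub : (A.nearEvent wo r i)ᶜ ⊆ {ω | r ^ 2 ≤ ‖A.err wo i ω‖ ^ 2} := fun ω hω =>
    pow_le_pow_left₀ hr.le (not_le.mp (Set.notMem_ofPred_iff.mp hω)).le 2
  rw [le_div_iff₀' (by positivity)]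
  calc r ^ 2 * P.real (A.nearEvent wo r i)ᶜ
      ≤ r ^ 2 * P.real {ω | r ^ 2 ≤ ‖A.err wo i ω‖ ^ 2} :=
        mul_le_mul_of_nonneg_left (measureReal_mono hsub) (sq_nonneg r)
    _ ≤ ∫ ω, ‖A.err wo i ω‖ ^ 2 ∂P := mul_meas_ge_le_integral_of_nonneg
      (ae_of_all _ fun ω => sq_nonneg _) (he.integrable_norm_pow two_ne_zero) _

namespace StandingConditions

variable [IsProbabilityMeasure P]

theorem memLp_noise (h : A.StandingConditions P J wo ν δ β σs Rs μub μbar σμ) (i : ℕ) :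
    MemLp (fun ω => A.noise J i (A.iter i ω) ω) 2 P :=
  h.noise.memLp_noise h.cost.measurable_gradient i (h.memLp_err i)

theorem memLp_noise_truncDisp (h : A.StandingConditions P J wo ν δ β σs Rs μub μbar σμ) (r : ℝ)
    (i : ℕ) : MemLp (fun ω => A.noise J i (wo + A.truncDisp wo r i ω) ω) 2 P := by
  have hnear := A.past_le i _ (A.measurableSet_nearEvent wo r i)
  refine (((h.memLp_noise i).indicator hnear).add
    ((h.noise.memLp_minimizer i).indicator hnear.compl)).ae_eq (ae_of_all _ fun ω => ?_)
  by_cases hω : ω ∈ A.nearEvent wo r i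
  · simp [hω, noise_truncDisp_of_mem hω]
  · simp [hω, noise_truncDisp_of_notMem hω]

theorem condExp_inner_noise_sq_le (h : A.StandingConditions P J wo ν δ β σs Rs μub μbar σμ)
    (hu : ‖u‖ = 1) (i : ℕ) :
    ∀ᵐ ω ∂P, P[fun ω => ⟪u, A.noise J i (A.iter i ω) ω⟫ ^ 2 | A.past i] ω
      ≤ β ^ 2 * ‖A.err wo i ω‖ ^ 2 + σs ^ 2 := by
  have hnoise := h.memLp_noise i
  have hnoise_sq := hnoise.integrable_norm_pow two_ne_zero
  have hmono := condExp_mono (m := A.past i) (integrable_inner_sq hnoise u) hnoise_sq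
    (ae_of_all _ fun ω => (inner_sq_le_mul_norm_sq u _).trans_eq (by rw [hu, one_pow, one_mul]))
  have hlift := condLExp_ofReal (A.past i) hnoise_sq (ae_of_all _ fun ω => sq_nonneg _)
  simp only [ENNReal.ofReal_pow (norm_nonneg _), ofReal_norm] at hlift
  filter_upwards [hmono, hlift, h.noise.second_moment i] with ω hω_mono hω_lift hω_le
  rw [hω_lift] at hω_le
  exact hω_mono.trans ((ENNReal.ofReal_le_ofReal_iff (by positivity)).mp hω_le)

theorem quadForm_condCov_truncDisp (h : A.StandingConditions P J wo ν δ β σs Rs μub μbar σμ)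
    (r : ℝ) (i : ℕ) (u : EuclideanSpace ℝ (Fin M)) :
    ∀ᵐ ω ∂P, ω ∈ A.nearEvent wo r i →
      quadForm (A.condCov P J i (fun ω' => wo + A.truncDisp wo r i ω') ω) u
        = P[fun ω => ⟪u, A.noise J i (A.iter i ω) ω⟫ ^ 2 | A.past i] ω := by
  have hnear := A.measurableSet_nearEvent wo r i
  have htrunc := h.memLp_noise_truncDisp r i
  have hcongr : (A.nearEvent wo r i).indicator
        (fun ω => ⟪u, A.noise J i (wo + A.truncDisp wo r i ω) ω⟫ ^ 2)
      = (A.nearEvent wo r i).indicator (fun ω => ⟪u, A.noise J i (A.iter i ω) ω⟫ ^ 2) :=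
    Set.indicator_congr fun ω hω => by rw [noise_truncDisp_of_mem hω]
  have hcond_trunc := condExp_indicator (integrable_inner_sq htrunc u) hnear
  rw [hcongr] at hcond_trunc
  filter_upwards [quadForm_condCov htrunc u, hcond_trunc,
    condExp_indicator (integrable_inner_sq (h.memLp_noise i) u) hnear]
    with ω hω_cov hω_trunc hω_iter hω
  rw [hω_iter, Set.indicator_of_mem hω, Set.indicator_of_mem hω] at hω_trunc
  rw [hω_cov, hω_trunc]

theorem setIntegral_inner_noise_sq (h : A.StandingConditions P J wo ν δ β σs Rs μub μbar σμ)
    (r : ℝ) (i : ℕ) (u : EuclideanSpace ℝ (Fin M)) :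
    ∫ ω in A.nearEvent wo r i, ⟪u, A.noise J i (A.iter i ω) ω⟫ ^ 2 ∂P
      = ∫ ω in A.nearEvent wo r i,
          quadForm (A.condCov P J i (fun ω' => wo + A.truncDisp wo r i ω') ω) u ∂P := by
  have hnear := A.measurableSet_nearEvent wo r i
  rw [← setIntegral_condExp (A.past_le i) (integrable_inner_sq (h.memLp_noise i) u) hnear]
  refine setIntegral_congr_ae (A.past_le i _ hnear) ?_
  filter_upwards [h.quadForm_condCov_truncDisp r i u] with ω hω hω_near using (hω hω_near).symm

/-- No moment bound is assumed at the minimizer itself: on the event that the iterate is near, its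
bound is inherited from the one at the iterate through the Lipschitz condition. -/
theorem abs_quadForm_condCov_minimizer_le
    (h : A.StandingConditions P J wo ν δ β σs Rs μub μbar σμ) (hL : A.CovLipschitzAt P J wo τ₂ κ r)
    (hκ : κ ∈ Set.Icc (1 : ℝ) 2) (hτ₂ : 0 ≤ τ₂) (hr : 0 ≤ r) (hu : ‖u‖ = 1) (i : ℕ) :
    ∀ᵐ ω ∂P, ω ∈ A.nearEvent wo r i →
      |quadForm (A.condCov P J i (fun _ => wo) ω) u|
        ≤ β ^ 2 * r ^ 2 + σs ^ 2 + τ₂ * (r + r ^ 2) := by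
  have hnonneg := condExp_nonneg (m := A.past i) (μ := P)
    (f := fun ω => ⟪u, A.noise J i (A.iter i ω) ω⟫ ^ 2) (ae_of_all _ fun ω => sq_nonneg _)
  filter_upwards [h.quadForm_condCov_truncDisp r i u, h.condExp_inner_noise_sq_le hu i, hnonneg,
    hL.abs_quadForm_sub_le hκ hτ₂ (A.measurable_truncDisp wo r i) (A.norm_truncDisp_le wo hr i)
      (h.memLp_noise_truncDisp r i) hu] with ω hω_cov hω_le hω_nonneg hω_lip hω
  have htrunc := A.norm_truncDisp_le wo hr i ω
  set x := P[fun ω => ⟪u, A.noise J i (A.iter i ω) ω⟫ ^ 2 | A.past i] ω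
  set y := quadForm (A.condCov P J i (fun _ => wo) ω) u
  have hx : |x| ≤ β ^ 2 * r ^ 2 + σs ^ 2 := by
    rw [abs_of_nonneg hω_nonneg]
    refine hω_le.trans ?_
    gcongr
    exact hω
  have hxy : |x - y| ≤ τ₂ * (r + r ^ 2) := by
    rw [hω_cov hω] at hω_lip
    exact hω_lip.trans (by gcongr)
  calc |y| = |x - (x - y)| := by rw [sub_sub_cancel]
    _ ≤ |x| + |x - y| := abs_sub _ _
    _ ≤ _ := add_le_add hx hxy

theorem tendsto_setIntegral_quadForm_condCov_minimizer_sub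
    (h : A.StandingConditions P J wo ν δ β σs Rs μub μbar σμ) (hL : A.CovLipschitzAt P J wo τ₂ κ r)
    (hκ : κ ∈ Set.Icc (1 : ℝ) 2) (hτ₂ : 0 ≤ τ₂) (hr : 0 ≤ r) (hu : ‖u‖ = 1) :
    Tendsto (fun i => ∫ ω in A.nearEvent wo r i,
      (quadForm (A.condCov P J i (fun _ => wo) ω) u - quadForm Rs u) ∂P) atTop (𝓝 0) := by
  have hnear : ∀ i, MeasurableSet (A.nearEvent wo r i) := fun i =>
    A.past_le i _ (A.measurableSet_nearEvent wo r i)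
  simp only [← integral_indicator (hnear _)]
  rw [← integral_zero Ω ℝ (μ := P)]
  refine tendsto_integral_of_dominated_convergence
    (fun _ => β ^ 2 * r ^ 2 + σs ^ 2 + τ₂ * (r + r ^ 2) + |quadForm Rs u|)
    (fun i => (((integrable_quadForm_condCov (h.noise.memLp_minimizer i) u).sub
      (integrable_const _)).indicator (hnear i)).1) (integrable_const _) (fun i => ?_) ?_
  · filter_upwards [h.abs_quadForm_condCov_minimizer_le hL hκ hτ₂ hr hu i] with ω hω
    by_cases hω_near : ω ∈ A.nearEvent wo r i
    · rw [Set.indicator_of_mem hω_near]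
      exact (abs_sub _ _).trans (by gcongr; exact hω hω_near)
    · rw [Set.indicator_of_notMem hω_near, norm_zero]
      positivity
  · have hcont : Continuous fun R : Matrix (Fin M) (Fin M) ℝ => quadForm R u := by
      simp only [quadForm_eq_sum]
      fun_prop
    filter_upwards [h.noise.tendsto_cov] with ω hω
    refine squeeze_zero_norm (fun i => norm_indicator_le_norm_self _ _) ?_
    simpa using (((hcont.tendsto Rs).comp hω).sub_const (quadForm Rs u)).norm

theorem abs_setIntegral_quadForm_condCov_truncDisp_sub_le
    (h : A.StandingConditions P J wo ν δ β σs Rs μub μbar σμ) (hL : A.CovLipschitzAt P J wo τ₂ κ r)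
    (hκ : κ ∈ Set.Icc (1 : ℝ) 2) (hτ₂ : 0 ≤ τ₂) (hr : 0 ≤ r) (hu : ‖u‖ = 1) (i : ℕ) :
    |∫ ω in A.nearEvent wo r i,
        (quadForm (A.condCov P J i (fun ω' => wo + A.truncDisp wo r i ω') ω) u
          - quadForm (A.condCov P J i (fun _ => wo) ω) u) ∂P|
      ≤ τ₂ * ∫ ω, ‖A.err wo i ω‖ + ‖A.err wo i ω‖ ^ 2 ∂P := by
  have hbound : Integrable (fun ω => τ₂ * (‖A.err wo i ω‖ + ‖A.err wo i ω‖ ^ 2)) P :=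
    (((h.memLp_err i).integrable one_le_two).norm.add (h.integrable_norm_err_sq i)).const_mul τ₂
  have hpoint : ∀ᵐ ω ∂P, ‖quadForm (A.condCov P J i (fun ω' => wo + A.truncDisp wo r i ω') ω) u
      - quadForm (A.condCov P J i (fun _ => wo) ω) u‖
        ≤ τ₂ * (‖A.err wo i ω‖ + ‖A.err wo i ω‖ ^ 2) := by
    filter_upwards [hL.abs_quadForm_sub_le hκ hτ₂ (A.measurable_truncDisp wo r i)
      (A.norm_truncDisp_le wo hr i) (h.memLp_noise_truncDisp r i) hu] with ω hω
    have hle := A.norm_truncDisp_le_norm_err wo r i ω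
    exact hω.trans (by gcongr)
  rw [← integral_const_mul]
  exact (norm_integral_le_of_norm_le hbound.restrict (ae_restrict_of_ae hpoint)).trans
    (setIntegral_le_integral hbound
      (ae_of_all _ fun ω => mul_nonneg hτ₂ (add_nonneg (norm_nonneg _) (sq_nonneg _))))

theorem setIntegral_compl_inner_noise_sq_le
    (h : A.StandingConditions P J wo ν δ β σs Rs μub μbar σμ) (hu : ‖u‖ = 1) (r : ℝ) (i : ℕ) :
    ∫ ω in (A.nearEvent wo r i)ᶜ, ⟪u, A.noise J i (A.iter i ω) ω⟫ ^ 2 ∂P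
      ≤ β ^ 2 * ∫ ω, ‖A.err wo i ω‖ ^ 2 ∂P + P.real (A.nearEvent wo r i)ᶜ * σs ^ 2 := by
  have hnoise := h.memLp_noise i
  calc ∫ ω in (A.nearEvent wo r i)ᶜ, ⟪u, A.noise J i (A.iter i ω) ω⟫ ^ 2 ∂P
      ≤ ∫ ω in (A.nearEvent wo r i)ᶜ, ‖A.noise J i (A.iter i ω) ω‖ ^ 2 ∂P :=
        integral_mono (integrable_inner_sq hnoise u).restrict
          (hnoise.integrable_norm_pow two_ne_zero).restrict
          fun ω => (inner_sq_le_mul_norm_sq u _).trans_eq (by rw [hu, one_pow, one_mul])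
    _ ≤ β ^ 2 * ∫ ω in (A.nearEvent wo r i)ᶜ, ‖A.err wo i ω‖ ^ 2 ∂P
          + P.real (A.nearEvent wo r i)ᶜ * σs ^ 2 :=
        h.noise.setIntegral_norm_noise_sq_le h.cost.measurable_gradient i (h.memLp_err i)
          (A.measurableSet_nearEvent wo r i).compl
    _ ≤ _ := by
        gcongr
        · exact ae_of_all _ fun ω => sq_nonneg _
        · exact h.integrable_norm_err_sq i
        · exact Measure.restrict_le_self

theorem abs_integral_inner_noise_sq_sub_le
    (h : A.StandingConditions P J wo ν δ β σs Rs μub μbar σμ) (hL : A.CovLipschitzAt P J wo τ₂ κ r)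
    (hκ : κ ∈ Set.Icc (1 : ℝ) 2) (hτ₂ : 0 ≤ τ₂) (hr : 0 ≤ r) (hu : ‖u‖ = 1) (i : ℕ) :
    |∫ ω, ⟪u, A.noise J i (A.iter i ω) ω⟫ ^ 2 ∂P - quadForm Rs u|
      ≤ τ₂ * ∫ ω, ‖A.err wo i ω‖ + ‖A.err wo i ω‖ ^ 2 ∂P
        + |∫ ω in A.nearEvent wo r i,
            (quadForm (A.condCov P J i (fun _ => wo) ω) u - quadForm Rs u) ∂P|
        + (β ^ 2 * ∫ ω, ‖A.err wo i ω‖ ^ 2 ∂P + P.real (A.nearEvent wo r i)ᶜ * σs ^ 2)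
        + P.real (A.nearEvent wo r i)ᶜ * |quadForm Rs u| := by
  set S := A.nearEvent wo r i
  have hS : MeasurableSet S := A.past_le i _ (A.measurableSet_nearEvent wo r i)
  set f₀ := fun ω => quadForm (A.condCov P J i (fun _ => wo) ω) u
  set f₁ := fun ω => quadForm (A.condCov P J i (fun ω' => wo + A.truncDisp wo r i ω') ω) u
  have hf₀ : Integrable f₀ P := integrable_quadForm_condCov (h.noise.memLp_minimizer i) u
  have hf₁ : Integrable f₁ P := integrable_quadForm_condCov (h.memLp_noise_truncDisp r i) u
  have hsplit : ∫ ω, ⟪u, A.noise J i (A.iter i ω) ω⟫ ^ 2 ∂P - quadForm Rs u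
      = ∫ ω in S, (f₁ ω - f₀ ω) ∂P + ∫ ω in S, (f₀ ω - quadForm Rs u) ∂P
        + ∫ ω in Sᶜ, ⟪u, A.noise J i (A.iter i ω) ω⟫ ^ 2 ∂P - P.real Sᶜ * quadForm Rs u := by
    rw [← integral_add_compl hS (integrable_inner_sq (h.memLp_noise i) u),
      h.setIntegral_inner_noise_sq, integral_sub hf₁.integrableOn hf₀.integrableOn,
      integral_sub hf₀.integrableOn (integrable_const _), setIntegral_const, smul_eq_mul,
      probReal_compl_eq_one_sub hS]
    ring
  rw [hsplit]
  refine (abs_sub _ _).trans (add_le_add ((abs_add_three _ _ _).trans (add_le_add_three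
    (h.abs_setIntegral_quadForm_condCov_truncDisp_sub_le hL hκ hτ₂ hr hu i) le_rfl ?_)) ?_)
  · rw [abs_of_nonneg (integral_nonneg fun ω => sq_nonneg _)]
    exact h.setIntegral_compl_inner_noise_sq_le hu r i
  · rw [abs_mul, abs_of_nonneg measureReal_nonneg]

theorem integral_norm_err_le (h : A.StandingConditions P J wo ν δ β σs Rs μub μbar σμ) {t : ℝ}
    (ht : 0 < t) (i : ℕ) :
    ∫ ω, ‖A.err wo i ω‖ ∂P ≤ (∫ ω, ‖A.err wo i ω‖ ^ 2 ∂P) / t + t := by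
  have he_sq := h.integrable_norm_err_sq i
  have hle : ∀ ω, ‖A.err wo i ω‖ ≤ ‖A.err wo i ω‖ ^ 2 / t + t := fun ω => by
    rw [← sub_nonneg]
    have hsquare : ‖A.err wo i ω‖ ^ 2 / t + t - ‖A.err wo i ω‖
        = ((‖A.err wo i ω‖ - t / 2) ^ 2 + 3 / 4 * t ^ 2) / t := by
      field_simp
      ring
    rw [hsquare]
    positivity
  have hmono := integral_mono ((h.memLp_err i).integrable one_le_two).norm
    ((he_sq.div_const t).add (integrable_const t)) hle
  refine hmono.trans_eq ((integral_add (he_sq.div_const t) (integrable_const t)).trans ?_)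
  rw [integral_div, integral_const, probReal_univ, one_smul]

end StandingConditions

/-- The factor in the asymptotic bound, proportional to `√μ_x`, on the deviation of the second
moment of the noise along a unit vector from its limit. It is built from `K`, a factor for which
`E ‖err‖² ≤ K μ_x`, and from a bound `L` for the limit. -/
noncomputable def noiseMomentConst (β σs τ₂ r K L : ℝ) : ℝ :=
  τ₂ * (2 * K + 1) + 1 + β ^ 2 * K + (σs ^ 2 + L) * (K / r ^ 2)

theorem noiseMomentConst_nonneg {K L : ℝ} (hτ₂ : 0 ≤ τ₂) (hK : 0 ≤ K) (hL : 0 ≤ L) :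
    0 ≤ noiseMomentConst β σs τ₂ r K L := by
  unfold noiseMomentConst
  positivity

theorem StandingConditions.eventually_abs_integral_inner_noise_sq_sub_le
    [IsProbabilityMeasure P] (h : A.StandingConditions P J wo ν δ β σs Rs μub μbar σμ)
    (hL : A.CovLipschitzAt P J wo τ₂ κ r) (hκ : κ ∈ Set.Icc (1 : ℝ) 2) (hτ₂ : 0 ≤ τ₂)
    (hr : 0 < r) (hu : ‖u‖ = 1) {K L t : ℝ} (hK : 0 ≤ K) (hRs : |quadForm Rs u| ≤ L) (ht : 0 < t)
    (ht1 : t ≤ 1) (hmsd : ∀ᶠ i in atTop, ∫ ω, ‖A.err wo i ω‖ ^ 2 ∂P ≤ K * t ^ 2) :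
    ∀ᶠ i in atTop, |∫ ω, ⟪u, A.noise J i (A.iter i ω) ω⟫ ^ 2 ∂P - quadForm Rs u|
      ≤ noiseMomentConst β σs τ₂ r K L * t := by
  have hcov := (h.tendsto_setIntegral_quadForm_condCov_minimizer_sub hL hκ hτ₂ hr.le hu).abs
  rw [abs_zero] at hcov
  filter_upwards [hmsd, hcov.eventually_le_const ht] with i hi_msd hi_cov
  have ht_sq : t ^ 2 ≤ t := pow_le_of_le_one ht.le ht1 two_ne_zero
  have hmsd_t : ∫ ω, ‖A.err wo i ω‖ ^ 2 ∂P ≤ K * t := hi_msd.trans (by gcongr)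
  have hfar : P.real (A.nearEvent wo r i)ᶜ ≤ K / r ^ 2 * t := by
    refine (measureReal_compl_nearEvent_le (h.memLp_err i) hr).trans ?_
    rw [div_mul_eq_mul_div]
    gcongr
  have hmean : ∫ ω, ‖A.err wo i ω‖ ∂P ≤ (K + 1) * t := by
    refine (h.integral_norm_err_le ht i).trans ?_
    have hdiv : (∫ ω, ‖A.err wo i ω‖ ^ 2 ∂P) / t ≤ K * t := by
      rw [div_le_iff₀ ht]
      linarith
    linarith
  have hsum : ∫ ω, ‖A.err wo i ω‖ + ‖A.err wo i ω‖ ^ 2 ∂P ≤ (2 * K + 1) * t := by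
    rw [integral_add ((h.memLp_err i).integrable one_le_two).norm (h.integrable_norm_err_sq i)]
    linarith
  calc |∫ ω, ⟪u, A.noise J i (A.iter i ω) ω⟫ ^ 2 ∂P - quadForm Rs u|
      ≤ _ := h.abs_integral_inner_noise_sq_sub_le hL hκ hτ₂ hr.le hu i
    _ ≤ τ₂ * ((2 * K + 1) * t) + t + (β ^ 2 * (K * t) + K / r ^ 2 * t * σs ^ 2)
          + K / r ^ 2 * t * L := by gcongr
    _ = noiseMomentConst β σs τ₂ r K L * t := by unfold noiseMomentConst; ring

end AsyncSGD

/-! ### Recursion for the eigenmodes -/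

theorem CostConditions.inner_hessian_eq_mul_inner {M : ℕ} {J : EuclideanSpace ℝ (Fin M) → ℝ}
    {wo u : EuclideanSpace ℝ (Fin M)} {ν δ lam : ℝ} (hJ : CostConditions J wo ν δ)
    (hlam : fderiv ℝ (gradient J) wo u = lam • u) (x : EuclideanSpace ℝ (Fin M)) :
    ⟪u, fderiv ℝ (gradient J) wo x⟫ = lam * ⟪u, x⟫ := by
  have hsymm : ⟪u, fderiv ℝ (gradient J) wo x⟫ = ⟪fderiv ℝ (gradient J) wo u, x⟫ :=
    (hJ.isSymmetric_hessian wo u x).symm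
  rw [hsymm, hlam, real_inner_smul_left]

namespace AsyncSGD

variable {Ω : Type*} [MeasurableSpace Ω] {M : ℕ} {A : AsyncSGD Ω M} {P : Measure Ω}
  {J : EuclideanSpace ℝ (Fin M) → ℝ} {wo u : EuclideanSpace ℝ (Fin M)}
  {ν δ β σs τ₂ κ r lam μub μbar σμ : ℝ} {Rs : Matrix (Fin M) (Fin M) ℝ}

theorem iter_sub_eq_neg_err (A : AsyncSGD Ω M) (wo : EuclideanSpace ℝ (Fin M)) (i : ℕ) (ω : Ω) :
    A.iter i ω - wo = -A.err wo i ω :=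
  (neg_sub _ _).symm

theorem norm_iter_sub (A : AsyncSGD Ω M) (wo : EuclideanSpace ℝ (Fin M)) (i : ℕ) (ω : Ω) :
    ‖A.iter i ω - wo‖ = ‖A.err wo i ω‖ :=
  norm_sub_rev _ _

theorem gradient_iter_eq (A : AsyncSGD Ω M) (J : EuclideanSpace ℝ (Fin M) → ℝ)
    (wo : EuclideanSpace ℝ (Fin M)) (i : ℕ) (ω : Ω) :
    gradient J (A.iter i ω)
      = -fderiv ℝ (gradient J) wo (A.err wo i ω) + gradientRemainder J wo (A.iter i ω) := by
  rw [gradientRemainder, iter_sub_eq_neg_err, map_neg]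
  abel

theorem inner_err_mul_inner_gradient (hJ : CostConditions J wo ν δ)
    (hlam : fderiv ℝ (gradient J) wo u = lam • u) (i : ℕ) (ω : Ω) :
    ⟪u, A.err wo i ω⟫ * ⟪u, gradient J (A.iter i ω)⟫
      = -lam * ⟪u, A.err wo i ω⟫ ^ 2
        + ⟪u, A.err wo i ω⟫ * ⟪u, gradientRemainder J wo (A.iter i ω)⟫ := by
  rw [gradient_iter_eq A J wo, inner_add_right, inner_neg_right,
    hJ.inner_hessian_eq_mul_inner hlam]
  ring

namespace StandingConditions

variable [IsProbabilityMeasure P]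

theorem memLp_gradientRemainder (h : A.StandingConditions P J wo ν δ β σs Rs μub μbar σμ) (i : ℕ) :
    MemLp (fun ω => gradientRemainder J wo (A.iter i ω)) 2 P := by
  have hstep := h.stochStep i
  have heq : (fun ω => gradientRemainder J wo (A.iter i ω))
      = fun ω => gradient J (A.iter i ω) + fderiv ℝ (gradient J) wo (A.err wo i ω) := by
    ext1 ω
    rw [A.gradient_iter_eq J wo]
    abel
  rw [heq]
  exact hstep.memLp_q.add ((fderiv ℝ (gradient J) wo).comp_memLp' hstep.memLp_e)

theorem integral_inner_err_mul_inner_gradient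
    (h : A.StandingConditions P J wo ν δ β σs Rs μub μbar σμ)
    (hlam : fderiv ℝ (gradient J) wo u = lam • u) (i : ℕ) :
    ∫ ω, ⟪u, A.err wo i ω⟫ * ⟪u, gradient J (A.iter i ω)⟫ ∂P
      = -lam * ∫ ω, ⟪u, A.err wo i ω⟫ ^ 2 ∂P
        + ∫ ω, ⟪u, A.err wo i ω⟫ * ⟪u, gradientRemainder J wo (A.iter i ω)⟫ ∂P := by
  have hcross : Integrable
      (fun ω => ⟪u, A.err wo i ω⟫ * ⟪u, gradientRemainder J wo (A.iter i ω)⟫) P :=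
    ((innerSL ℝ u).comp_memLp' (h.memLp_err i)).integrable_mul
      ((innerSL ℝ u).comp_memLp' (h.memLp_gradientRemainder i))
  simp_rw [inner_err_mul_inner_gradient h.cost hlam]
  rw [integral_add ((integrable_inner_sq (h.memLp_err i) u).const_mul _) hcross,
    integral_const_mul]

theorem integral_inner_err_sq_succ (h : A.StandingConditions P J wo ν δ β σs Rs μub μbar σμ)
    (hlam : fderiv ℝ (gradient J) wo u = lam • u) (i : ℕ) :
    ∫ ω, ⟪u, A.err wo (i + 1) ω⟫ ^ 2 ∂P
      = (1 - 2 * lam * μbar) * ∫ ω, ⟪u, A.err wo i ω⟫ ^ 2 ∂P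
        + 2 * μbar * ∫ ω, ⟪u, A.err wo i ω⟫ * ⟪u, gradientRemainder J wo (A.iter i ω)⟫ ∂P
        + μbar * muX μbar σμ * (∫ ω, ⟪u, gradient J (A.iter i ω)⟫ ^ 2 ∂P
          + ∫ ω, ⟪u, A.noise J i (A.iter i ω) ω⟫ ^ 2 ∂P) := by
  have hrec := ((h.stochStep i).comp (innerSL ℝ u)).integral_norm_sq_update
  have hmul : ∀ x y : ℝ, ⟪x, y⟫ = x * y := fun x y => mul_comm y x
  simp only [innerSL_apply_apply, Real.norm_eq_abs, sq_abs, hmul] at hrec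
  simp_rw [A.err_succ J wo i, inner_add_right, real_inner_smul_right, inner_add_right,
    ← smul_eq_mul (A.step i _)]
  rw [hrec, h.integral_inner_err_mul_inner_gradient hlam, h.step.mean i, h.step.integral_step_sq]
  ring

theorem abs_integral_inner_err_mul_inner_gradientRemainder_le
    (h : A.StandingConditions P J wo ν δ β σs Rs μub μbar σμ) (hu : ‖u‖ = 1) (i : ℕ) :
    |∫ ω, ⟪u, A.err wo i ω⟫ * ⟪u, gradientRemainder J wo (A.iter i ω)⟫ ∂P|
      ≤ ∫ ω, ‖A.err wo i ω‖ * ‖gradientRemainder J wo (A.iter i ω)‖ ∂P := by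
  have hinner : ∀ x : EuclideanSpace ℝ (Fin M), ‖⟪u, x⟫‖ ≤ ‖x‖ := fun x => by
    simpa only [hu, one_mul] using norm_inner_le_norm (𝕜 := ℝ) u x
  rw [← Real.norm_eq_abs]
  refine norm_integral_le_of_norm_le
    ((h.memLp_err i).norm.integrable_mul (h.memLp_gradientRemainder i).norm)
    (ae_of_all _ fun ω => ?_)
  rw [norm_mul]
  exact mul_le_mul (hinner _) (hinner _) (norm_nonneg _) (norm_nonneg _)

theorem integral_inner_gradient_sq_le (h : A.StandingConditions P J wo ν δ β σs Rs μub μbar σμ)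
    (hu : ‖u‖ = 1) (i : ℕ) :
    ∫ ω, ⟪u, gradient J (A.iter i ω)⟫ ^ 2 ∂P ≤ δ ^ 2 * ∫ ω, ‖A.err wo i ω‖ ^ 2 ∂P := by
  rw [← integral_const_mul]
  refine integral_mono (integrable_inner_sq (h.stochStep i).memLp_q u)
    ((h.integrable_norm_err_sq i).const_mul _) fun ω => ?_
  calc ⟪u, gradient J (A.iter i ω)⟫ ^ 2 ≤ ‖gradient J (A.iter i ω)‖ ^ 2 := by
        simpa only [hu, one_pow, one_mul] using inner_sq_le_mul_norm_sq u (gradient J (A.iter i ω))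
    _ ≤ (δ * ‖A.err wo i ω‖) ^ 2 := by gcongr; exact norm_gradient_iter_le h.cost i ω
    _ = δ ^ 2 * ‖A.err wo i ω‖ ^ 2 := mul_pow _ _ _

theorem eventually_abs_mode_perturbation_le
    (h : A.StandingConditions P J wo ν δ β σs Rs μub μbar σμ) (hL : A.CovLipschitzAt P J wo τ₂ κ r)
    (hκ : κ ∈ Set.Icc (1 : ℝ) 2) (hτ₂ : 0 ≤ τ₂) (hr : 0 < r) (hu : ‖u‖ = 1) {K C L t : ℝ}
    (hK : 0 ≤ K) (hRs : |quadForm Rs u| ≤ L) (ht : 0 < t) (ht1 : t ≤ 1)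
    (hmsd : ∀ᶠ i in atTop, ∫ ω, ‖A.err wo i ω‖ ^ 2 ∂P ≤ K * t ^ 2)
    (hrem : ∀ᶠ i in atTop,
      ∫ ω, ‖A.err wo i ω‖ * ‖gradientRemainder J wo (A.iter i ω)‖ ∂P ≤ C * t ^ 3) :
    ∀ᶠ i in atTop,
      |2 * (∫ ω, ⟪u, A.err wo i ω⟫ * ⟪u, gradientRemainder J wo (A.iter i ω)⟫ ∂P)
        + t ^ 2 * (∫ ω, ⟪u, gradient J (A.iter i ω)⟫ ^ 2 ∂P)
        + t ^ 2 * (∫ ω, ⟪u, A.noise J i (A.iter i ω) ω⟫ ^ 2 ∂P - quadForm Rs u)|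
      ≤ (2 * C + δ ^ 2 * K + noiseMomentConst β σs τ₂ r K L) * t ^ 3 := by
  filter_upwards [hmsd, hrem,
    h.eventually_abs_integral_inner_noise_sq_sub_le hL hκ hτ₂ hr hu hK hRs ht ht1 hmsd]
    with i hi_msd hi_rem hi_noise
  have hcross := (h.abs_integral_inner_err_mul_inner_gradientRemainder_le hu i).trans hi_rem
  have ht_sq : t ^ 2 ≤ t := pow_le_of_le_one ht.le ht1 two_ne_zero
  have hgrad : |∫ ω, ⟪u, gradient J (A.iter i ω)⟫ ^ 2 ∂P| ≤ δ ^ 2 * (K * t) := by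
    rw [abs_of_nonneg (integral_nonneg fun ω => sq_nonneg _)]
    refine (h.integral_inner_gradient_sq_le hu i).trans ?_
    gcongr
    exact hi_msd.trans (by gcongr)
  refine (abs_add_three _ _ _).trans ?_
  rw [abs_mul, abs_mul, abs_mul, abs_two, abs_of_nonneg (sq_nonneg t)]
  calc _ ≤ 2 * (C * t ^ 3) + t ^ 2 * (δ ^ 2 * (K * t))
        + t ^ 2 * (noiseMomentConst β σs τ₂ r K L * t) := by gcongr
    _ = (2 * C + δ ^ 2 * K + noiseMomentConst β σs τ₂ r K L) * t ^ 3 := by ring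

-- `μ_x uᵀ R_s u / (2 λ)` is the fixed point of the unperturbed recursion
-- `x ↦ (1 - 2 λ μbar) x + μbar μ_x uᵀ R_s u`.
theorem eventually_abs_integral_inner_err_sq_sub_le
    (h : A.StandingConditions P J wo ν δ β σs Rs μub μbar σμ) (hL : A.CovLipschitzAt P J wo τ₂ κ r)
    (hκ : κ ∈ Set.Icc (1 : ℝ) 2) (hτ₂ : 0 ≤ τ₂) (hr : 0 < r) (hu : ‖u‖ = 1)
    (heig : fderiv ℝ (gradient J) wo u = lam • u) (hlam : lam ∈ Set.Icc ν δ) {K C L t : ℝ}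
    (hK : 0 ≤ K) (hC : 0 ≤ C) (hRs : |quadForm Rs u| ≤ L) (ht : 0 < t) (ht1 : t ≤ 1)
    (hμt : muX μbar σμ = t ^ 2) (htδ : 2 * δ * t ^ 2 ≤ 1)
    (hmsd : ∀ᶠ i in atTop, ∫ ω, ‖A.err wo i ω‖ ^ 2 ∂P ≤ K * t ^ 2)
    (hrem : ∀ᶠ i in atTop,
      ∫ ω, ‖A.err wo i ω‖ * ‖gradientRemainder J wo (A.iter i ω)‖ ∂P ≤ C * t ^ 3) :
    ∀ᶠ i in atTop,
      |∫ ω, ⟪u, A.err wo i ω⟫ ^ 2 ∂P - t ^ 2 * (quadForm Rs u / (2 * lam))|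
        ≤ ((2 * C + δ ^ 2 * K + noiseMomentConst β σs τ₂ r K L) / ν + 1) * t ^ 3 := by
  have hν := h.cost.pos
  have hμ := h.step.mean_pos
  have hlam_pos : 0 < lam := hν.trans_le hlam.1
  have hδ := h.cost.pos_upper.le
  set N := 2 * C + δ ^ 2 * K + noiseMomentConst β σs τ₂ r K L
  have hN : 0 ≤ N := by
    have hnoise := noiseMomentConst_nonneg (β := β) (σs := σs) (r := r) hτ₂ hK
      ((abs_nonneg _).trans hRs)
    exact add_nonneg (by positivity) hnoise
  refine eventually_abs_sub_le_of_contraction (a := 2 * lam * μbar) (b := μbar * (N * t ^ 3))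
    (e := fun i => μbar
      * (2 * (∫ ω, ⟪u, A.err wo i ω⟫ * ⟪u, gradientRemainder J wo (A.iter i ω)⟫ ∂P)
        + t ^ 2 * (∫ ω, ⟪u, gradient J (A.iter i ω)⟫ ^ 2 ∂P)
        + t ^ 2 * (∫ ω, ⟪u, A.noise J i (A.iter i ω) ω⟫ ^ 2 ∂P - quadForm Rs u)))
    (by positivity) ?_ ?_ (Eventually.of_forall fun i => ?_) ?_
  · calc 2 * lam * μbar ≤ 2 * δ * t ^ 2 := by
          gcongr
          exacts [hlam.2, hμt ▸ le_muX hμ]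
      _ ≤ 1 := htδ
  · calc μbar * (N * t ^ 3) / (2 * lam * μbar) = N / (2 * lam) * t ^ 3 := by field_simp
      _ ≤ N / ν * t ^ 3 := by
          gcongr
          linarith [hlam.1]
      _ < (N / ν + 1) * t ^ 3 := by
          gcongr
          exact lt_add_one _
  · rw [h.integral_inner_err_sq_succ heig, hμt]
    field_simp
    ring
  · filter_upwards [h.eventually_abs_mode_perturbation_le hL hκ hτ₂ hr hu hK hRs ht ht1 hmsd hrem]
      with i hi
    rw [abs_mul, abs_of_pos hμ]
    gcongr

theorem integral_norm_err_sq_eq_sum (h : A.StandingConditions P J wo ν δ β σs Rs μub μbar σμ)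
    (b : OrthonormalBasis (Fin M) ℝ (EuclideanSpace ℝ (Fin M))) (i : ℕ) :
    ∫ ω, ‖A.err wo i ω‖ ^ 2 ∂P = ∑ k, ∫ ω, ⟪b k, A.err wo i ω⟫ ^ 2 ∂P := by
  rw [← integral_finsetSum _ fun k _ => integrable_inner_sq (h.memLp_err i) (b k)]
  simp only [← b.sum_sq_norm_inner_right, Real.norm_eq_abs, sq_abs]

theorem integrable_cost (h : A.StandingConditions P J wo ν δ β σs Rs μub μbar σμ) (i : ℕ) :
    Integrable (fun ω => J (A.iter i ω) - J wo) P := by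
  refine ((h.integrable_norm_err_sq i).const_mul δ).mono'
    ((h.cost.differentiable.continuous.measurable.comp
      (A.measurable_iter i)).sub_const _).aestronglyMeasurable (ae_of_all _ fun ω => ?_)
  rw [← norm_iter_sub]
  exact h.cost.abs_sub_le (A.iter i ω)

theorem integral_cost_eq_sum (h : A.StandingConditions P J wo ν δ β σs Rs μub μbar σμ)
    {b : OrthonormalBasis (Fin M) ℝ (EuclideanSpace ℝ (Fin M))} {lam : Fin M → ℝ}
    (hb : ∀ k, fderiv ℝ (gradient J) wo (b k) = lam k • b k) (i : ℕ) :
    ∫ ω, (J (A.iter i ω) - J wo) ∂P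
      = ∑ k, lam k / 2 * ∫ ω, ⟪b k, A.err wo i ω⟫ ^ 2 ∂P
        + ∫ ω, costRemainder J wo (A.iter i ω) ∂P := by
  have hmode : ∀ k ∈ Finset.univ, Integrable (fun ω => lam k / 2 * ⟪b k, A.err wo i ω⟫ ^ 2) P :=
    fun k _ => (integrable_inner_sq (h.memLp_err i) (b k)).const_mul _
  have hexpand : ∀ ω, costRemainder J wo (A.iter i ω)
      = (J (A.iter i ω) - J wo) - ∑ k, lam k / 2 * ⟪b k, A.err wo i ω⟫ ^ 2 := fun ω => by
    rw [costRemainder, iter_sub_eq_neg_err, map_neg, inner_neg_neg, ← b.sum_inner_mul_inner,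
      Finset.mul_sum]
    congr 1
    refine Finset.sum_congr rfl fun k _ => ?_
    rw [h.cost.inner_hessian_eq_mul_inner (hb k), real_inner_comm]
    ring
  simp_rw [hexpand]
  rw [integral_sub (h.integrable_cost i) (integrable_finsetSum _ hmode),
    integral_finsetSum _ hmode]
  simp_rw [integral_const_mul]
  ring

end StandingConditions

end AsyncSGD

/-! ### Steady-state performance -/

/-- The factor of `μ_x ^ (3 / 2)` in the asymptotic bounds on the expected remainders of the
gradient and of the cost function. -/
noncomputable def remainderConst (ν δ σs τ r σ₄ ρ : ℝ) : ℝ :=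
  (τ + 2 * δ / r + 2 * δ) * (meanFourthConst ν σ₄ ρ + 2 * meanSquareConst ν σs)

open scoped Matrix.Norms.L2Operator in
/-- The factor of `μ_x ^ (3 / 2)` in the asymptotic error of the second moment of a single mode,
that is, of the component of `err` along a unit eigenvector of the Hessian. -/
noncomputable def modeConst {M : ℕ} (ν δ β σs τ τ₂ r σ₄ ρ : ℝ) (Rs : Matrix (Fin M) (Fin M) ℝ) :
    ℝ :=
  (2 * remainderConst ν δ σs τ r σ₄ ρ + δ ^ 2 * meanSquareConst ν σs
    + AsyncSGD.noiseMomentConst β σs τ₂ r (meanSquareConst ν σs) ‖Rs‖) / ν + 1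

/-- The factor of `μ_x ^ (3 / 2)` in the asymptotic error of `E ‖err‖²`: the modes are summed. -/
noncomputable def deviationConst {M : ℕ} (ν δ β σs τ τ₂ r σ₄ ρ : ℝ)
    (Rs : Matrix (Fin M) (Fin M) ℝ) : ℝ :=
  M * modeConst ν δ β σs τ τ₂ r σ₄ ρ Rs

/-- The factor of `μ_x ^ (3 / 2)` in the asymptotic error of the excess risk: the modes are summed
with weights `λ / 2 ≤ δ / 2`, and the cost remainder is added. -/
noncomputable def excessRiskConst {M : ℕ} (ν δ β σs τ τ₂ r σ₄ ρ : ℝ)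
    (Rs : Matrix (Fin M) (Fin M) ℝ) : ℝ :=
  M * (δ / 2 * modeConst ν δ β σs τ τ₂ r σ₄ ρ Rs) + remainderConst ν δ σs τ r σ₄ ρ

/-- The upper bound on `μ_x` below which the asymptotic expansions hold. -/
noncomputable def stepThreshold (ν δ β β₄ ρ : ℝ) : ℝ :=
  min (min (ν / (δ ^ 2 + β ^ 2)) (1 / (2 * δ))) (min 1 (ν / fourthMomentGain ν δ β₄ ρ))

section Constants

variable {ν δ β σs τ r β₄ σ₄ ρ : ℝ}

theorem remainderConst_nonneg (hν : 0 < ν) (hδ : 0 ≤ δ) (hτ : 0 ≤ τ) (hr : 0 < r) :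
    0 ≤ remainderConst ν δ σs τ r σ₄ ρ := by
  have hfour := meanFourthConst_nonneg (σ₄ := σ₄) (ρ := ρ) hν
  have hsq := meanSquareConst_nonneg (σs := σs) hν
  exact mul_nonneg (by positivity) (by linarith)

theorem fourthMomentGain_pos (hν : 0 < ν) (hδ : 0 < δ) : 0 < fourthMomentGain ν δ β₄ ρ := by
  unfold fourthMomentGain
  positivity

theorem stepThreshold_pos (hν : 0 < ν) (hδ : 0 < δ) : 0 < stepThreshold ν δ β β₄ ρ := by
  have hgain := fourthMomentGain_pos (β₄ := β₄) (ρ := ρ) hν hδ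
  unfold stepThreshold
  positivity

theorem stepThreshold_le (hν : 0 ≤ ν) : stepThreshold ν δ β β₄ ρ ≤ 2 * ν / (δ ^ 2 + β ^ 2) := by
  refine ((min_le_left _ _).trans (min_le_left _ _)).trans ?_
  gcongr
  linarith

theorem lt_stepThreshold_iff (hν : 0 < ν) (hδ : 0 < δ) {x : ℝ} :
    x < stepThreshold ν δ β β₄ ρ ↔
      (x * (δ ^ 2 + β ^ 2) < ν ∧ x * (2 * δ) < 1) ∧ x < 1 ∧ x * fourthMomentGain ν δ β₄ ρ < ν := by
  have hsum : 0 < δ ^ 2 + β ^ 2 := by positivity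
  have hδ_two : 0 < 2 * δ := by positivity
  rw [stepThreshold, lt_min_iff, lt_min_iff, lt_min_iff, lt_div_iff₀ hsum, lt_div_iff₀ hδ_two,
    lt_div_iff₀ (fourthMomentGain_pos hν hδ)]

theorem rpow_three_halves_eq_sqrt_pow_three {x : ℝ} (hx : 0 ≤ x) : x ^ (3 / 2 : ℝ) = √x ^ 3 := by
  rw [Real.rpow_div_two_eq_sqrt 3 hx]
  exact Real.rpow_natCast _ 3

end Constants

namespace AsyncSGD

variable {Ω : Type*} [MeasurableSpace Ω] {M : ℕ} {A : AsyncSGD Ω M} {P : Measure Ω}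
  {J : EuclideanSpace ℝ (Fin M) → ℝ} {wo : EuclideanSpace ℝ (Fin M)}
  {ν δ β σs τ τ₂ κ r β₄ σ₄ ρ μub μbar σμ : ℝ} {Rs : Matrix (Fin M) (Fin M) ℝ}

namespace StandingConditions

variable [IsProbabilityMeasure P]

theorem integral_norm_err_mul_norm_gradientRemainder_le
    (h : A.StandingConditions P J wo ν δ β σs Rs μub μbar σμ) (hr : 0 < r) (hτ : 0 ≤ τ)
    (hH : HessianLipschitzAt J wo τ r) (i : ℕ) :
    ∫ ω, ‖A.err wo i ω‖ * ‖gradientRemainder J wo (A.iter i ω)‖ ∂P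
      ≤ (τ + 2 * δ / r + 2 * δ)
        * ∫ ω, min (‖A.err wo i ω‖ ^ 2) (‖A.err wo i ω‖ ^ 3) ∂P := by
  rw [← integral_const_mul]
  refine integral_mono ((h.memLp_err i).norm.integrable_mul (h.memLp_gradientRemainder i).norm)
    ((h.integrable_min_norm_err i).const_mul _) fun ω => ?_
  have hrem := h.cost.norm_gradientRemainder_le_min hr hτ hH (A.iter i ω)
  rw [norm_iter_sub] at hrem
  calc ‖A.err wo i ω‖ * ‖gradientRemainder J wo (A.iter i ω)‖
      ≤ ‖A.err wo i ω‖ * ((τ + 2 * δ / r + 2 * δ) * min ‖A.err wo i ω‖ (‖A.err wo i ω‖ ^ 2)) := by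
        gcongr
    _ = (τ + 2 * δ / r + 2 * δ)
        * min (‖A.err wo i ω‖ * ‖A.err wo i ω‖) (‖A.err wo i ω‖ * ‖A.err wo i ω‖ ^ 2) := by
        rw [← mul_min_of_nonneg _ _ (norm_nonneg _)]
        ring
    _ = (τ + 2 * δ / r + 2 * δ) * min (‖A.err wo i ω‖ ^ 2) (‖A.err wo i ω‖ ^ 3) := by
        rw [← sq, ← pow_succ']

theorem abs_integral_costRemainder_le
    (h : A.StandingConditions P J wo ν δ β σs Rs μub μbar σμ) (hr : 0 < r) (hτ : 0 ≤ τ)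
    (hH : HessianLipschitzAt J wo τ r) (i : ℕ) :
    |∫ ω, costRemainder J wo (A.iter i ω) ∂P|
      ≤ (τ + 2 * δ / r + 2 * δ)
        * ∫ ω, min (‖A.err wo i ω‖ ^ 2) (‖A.err wo i ω‖ ^ 3) ∂P := by
  rw [← integral_const_mul, ← Real.norm_eq_abs]
  refine norm_integral_le_of_norm_le ((h.integrable_min_norm_err i).const_mul _)
    (ae_of_all _ fun ω => ?_)
  simpa only [norm_iter_sub, Real.norm_eq_abs] using
    h.cost.abs_costRemainder_le_min hr hτ hH (A.iter i ω)

end StandingConditions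

/-- The assumptions under which the steady-state performance is expanded: the standing conditions,
the two smoothness conditions, a constant Hessian or the fourth-order moment conditions, and a
small `μ_x`. -/
structure PerformanceConditions (A : AsyncSGD Ω M) (P : Measure Ω)
    (J : EuclideanSpace ℝ (Fin M) → ℝ) (wo : EuclideanSpace ℝ (Fin M))
    (ν δ β σs τ τ₂ κ r β₄ σ₄ ρ : ℝ) (Rs : Matrix (Fin M) (Fin M) ℝ) (μub μbar σμ : ℝ) : Prop
    extends A.StandingConditions P J wo ν δ β σs Rs μub μbar σμ where
  radius_pos : 0 < r
  hessianConst_nonneg : 0 ≤ τ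
  covConst_nonneg : 0 ≤ τ₂
  exponent_mem : κ ∈ Set.Icc (1 : ℝ) 2
  hessian : HessianLipschitzAt J wo τ r
  cov : A.CovLipschitzAt P J wo τ₂ κ r
  fourth : (∀ w, hessianMatrix J w = hessianMatrix J wo) ∨
    A.FourthMomentConditions P J wo β₄ σ₄ ρ μbar σμ
  small : muX μbar σμ < stepThreshold ν δ β β₄ ρ

namespace PerformanceConditions

theorem muX_sq_mul_fourthMomentGain_le
    (h : A.PerformanceConditions P J wo ν δ β σs τ τ₂ κ r β₄ σ₄ ρ Rs μub μbar σμ) :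
    muX μbar σμ ^ 2 * fourthMomentGain ν δ β₄ ρ ≤ ν := by
  obtain ⟨-, h_one, h_gain⟩ := (lt_stepThreshold_iff h.cost.pos h.cost.pos_upper).1 h.small
  have hx := muX_pos (σμ := σμ) h.step.mean_pos
  have hgain := fourthMomentGain_pos (β₄ := β₄) (ρ := ρ) h.cost.pos h.cost.pos_upper
  calc muX μbar σμ ^ 2 * fourthMomentGain ν δ β₄ ρ
      ≤ muX μbar σμ * fourthMomentGain ν δ β₄ ρ := by
        gcongr
        exact pow_le_of_le_one hx.le h_one.le two_ne_zero
    _ ≤ ν := h_gain.le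

variable [IsProbabilityMeasure P]

theorem eventually_integral_norm_err_sq_le
    (h : A.PerformanceConditions P J wo ν δ β σs τ τ₂ κ r β₄ σ₄ ρ Rs μub μbar σμ) :
    ∀ᶠ i in atTop, ∫ ω, ‖A.err wo i ω‖ ^ 2 ∂P ≤ meanSquareConst ν σs * muX μbar σμ :=
  h.toStandingConditions.eventually_integral_norm_err_sq_le
    ((lt_stepThreshold_iff h.cost.pos h.cost.pos_upper).1 h.small).1.1.le

theorem eventually_remainders_le
    (h : A.PerformanceConditions P J wo ν δ β σs τ τ₂ κ r β₄ σ₄ ρ Rs μub μbar σμ) :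
    ∀ᶠ i in atTop,
      ∫ ω, ‖A.err wo i ω‖ * ‖gradientRemainder J wo (A.iter i ω)‖ ∂P
          ≤ remainderConst ν δ σs τ r σ₄ ρ * √(muX μbar σμ) ^ 3 ∧
        |∫ ω, costRemainder J wo (A.iter i ω) ∂P|
          ≤ remainderConst ν δ σs τ r σ₄ ρ * √(muX μbar σμ) ^ 3 := by
  have hx := muX_pos (σμ := σμ) h.step.mean_pos
  have hδ := h.cost.pos_upper.le
  have hr := h.radius_pos
  have hτ := h.hessianConst_nonneg
  rcases h.fourth with hconst | h₄
  · have hnonneg : 0 ≤ remainderConst ν δ σs τ r σ₄ ρ * √(muX μbar σμ) ^ 3 :=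
      mul_nonneg (remainderConst_nonneg h.cost.pos hδ hτ hr) (by positivity)
    simpa only [h.cost.gradientRemainder_eq_zero hconst, h.cost.costRemainder_eq_zero hconst,
      norm_zero, mul_zero, integral_zero, abs_zero, and_self] using
      Eventually.of_forall fun _ => hnonneg
  · have hsmall := (lt_stepThreshold_iff h.cost.pos h.cost.pos_upper).1 h.small
    filter_upwards [h.toStandingConditions.eventually_integral_min_norm_err_le h₄ hsmall.1.1.le
      h.muX_sq_mul_fourthMomentGain_le (Real.sqrt_pos.2 hx) (Real.sq_sqrt hx.le).symm] with i hi
    have hmul := mul_le_mul_of_nonneg_left hi (by positivity : 0 ≤ τ + 2 * δ / r + 2 * δ)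
    rw [← mul_assoc] at hmul
    exact ⟨(h.integral_norm_err_mul_norm_gradientRemainder_le hr hτ h.hessian i).trans hmul,
      (h.abs_integral_costRemainder_le hr hτ h.hessian i).trans hmul⟩

open scoped Matrix.Norms.L2Operator in
theorem eventually_abs_integral_inner_err_sq_sub_le
    (h : A.PerformanceConditions P J wo ν δ β σs τ τ₂ κ r β₄ σ₄ ρ Rs μub μbar σμ)
    {u : EuclideanSpace ℝ (Fin M)} {lam : ℝ} (hu : ‖u‖ = 1)
    (heig : fderiv ℝ (gradient J) wo u = lam • u) (hlam : lam ∈ Set.Icc ν δ) :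
    ∀ᶠ i in atTop,
      |∫ ω, ⟪u, A.err wo i ω⟫ ^ 2 ∂P - muX μbar σμ * (quadForm Rs u / (2 * lam))|
        ≤ modeConst ν δ β σs τ τ₂ r σ₄ ρ Rs * √(muX μbar σμ) ^ 3 := by
  obtain ⟨⟨-, h_curv⟩, h_one, -⟩ :=
    (lt_stepThreshold_iff h.cost.pos h.cost.pos_upper).1 h.small
  have hx := muX_pos (σμ := σμ) h.step.mean_pos
  have hsq := Real.sq_sqrt hx.le
  have hRs : |quadForm Rs u| ≤ ‖Rs‖ := by
    simpa only [hu, one_pow, mul_one] using abs_quadForm_le Rs u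
  have hmode := h.toStandingConditions.eventually_abs_integral_inner_err_sq_sub_le h.cov
    h.exponent_mem h.covConst_nonneg h.radius_pos hu heig hlam
    (meanSquareConst_nonneg h.cost.pos)
    (remainderConst_nonneg h.cost.pos h.cost.pos_upper.le h.hessianConst_nonneg h.radius_pos)
    hRs (Real.sqrt_pos.2 hx) (Real.sqrt_le_one.2 h_one.le) hsq.symm
    (by rw [hsq]; linarith) (by simpa only [hsq] using h.eventually_integral_norm_err_sq_le)
    (h.eventually_remainders_le.mono fun i hi => hi.1)
  rwa [hsq] at hmode

theorem eventually_abs_integral_norm_err_sq_sub_le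
    (h : A.PerformanceConditions P J wo ν δ β σs τ τ₂ κ r β₄ σ₄ ρ Rs μub μbar σμ) :
    ∀ᶠ i in atTop,
      |∫ ω, ‖A.err wo i ω‖ ^ 2 ∂P - muX μbar σμ / 2 * ((hessianMatrix J wo)⁻¹ * Rs).trace|
        ≤ deviationConst ν δ β σs τ τ₂ r σ₄ ρ Rs * √(muX μbar σμ) ^ 3 := by
  obtain ⟨b, lam, hb, hlam⟩ := h.cost.exists_eigenbasis
  have htrace : muX μbar σμ / 2 * ((hessianMatrix J wo)⁻¹ * Rs).trace
      = ∑ k, 1 * (muX μbar σμ * (quadForm Rs (b k) / (2 * lam k))) := by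
    rw [trace_inv_mul_eq_sum_quadForm_div (h.cost.hessianMatrix_posDef wo).isUnit Rs fun k => by
      rw [toEuclideanCLM_hessianMatrix, hb], Finset.mul_sum]
    refine Finset.sum_congr rfl fun k _ => ?_
    have hlam_ne : lam k ≠ 0 := (h.cost.pos.trans_le (hlam k).1).ne'
    field_simp
  filter_upwards [eventually_abs_sum_sub_le (w := fun _ => 1) (W := 1)
    (fun k => h.eventually_abs_integral_inner_err_sq_sub_le (b.norm_eq_one k) (hb k) (hlam k))
    fun _ => abs_one.le] with i hi
  rw [h.integral_norm_err_sq_eq_sum b, htrace, deviationConst, mul_assoc]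
  simpa only [one_mul, Fintype.card_fin] using hi

theorem eventually_abs_integral_cost_sub_le
    (h : A.PerformanceConditions P J wo ν δ β σs τ τ₂ κ r β₄ σ₄ ρ Rs μub μbar σμ) :
    ∀ᶠ i in atTop,
      |∫ ω, (J (A.iter i ω) - J wo) ∂P - muX μbar σμ / 4 * Rs.trace|
        ≤ excessRiskConst ν δ β σs τ τ₂ r σ₄ ρ Rs * √(muX μbar σμ) ^ 3 := by
  obtain ⟨b, lam, hb, hlam⟩ := h.cost.exists_eigenbasis
  have hlam_pos : ∀ k, 0 < lam k := fun k => h.cost.pos.trans_le (hlam k).1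
  have htrace : muX μbar σμ / 4 * Rs.trace
      = ∑ k, lam k / 2 * (muX μbar σμ * (quadForm Rs (b k) / (2 * lam k))) := by
    rw [trace_eq_sum_quadForm Rs b, Finset.mul_sum]
    refine Finset.sum_congr rfl fun k _ => ?_
    have hlam_ne := (hlam_pos k).ne'
    field_simp
    ring
  have hweight : ∀ k, |lam k / 2| ≤ δ / 2 := fun k => by
    rw [abs_of_pos (half_pos (hlam_pos k))]
    linarith [(hlam k).2]
  filter_upwards [h.eventually_remainders_le, eventually_abs_sum_sub_le
    (fun k => h.eventually_abs_integral_inner_err_sq_sub_le (b.norm_eq_one k) (hb k) (hlam k))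
    hweight] with i hi_rem hi_modes
  rw [h.integral_cost_eq_sum hb, htrace, add_sub_right_comm, excessRiskConst, add_mul]
  refine (abs_add_le _ _).trans (add_le_add ?_ hi_rem.2)
  simpa only [Fintype.card_fin, mul_assoc] using hi_modes

end PerformanceConditions

end AsyncSGD

theorem lemma2 {M : ℕ} (J : EuclideanSpace ℝ (Fin M) → ℝ) (wo : EuclideanSpace ℝ (Fin M))
    (ν δ β σs τ τ₂ κ r β₄ σ₄ ρ : ℝ) (Rs : Matrix (Fin M) (Fin M) ℝ)
    (hJ : CostConditions J wo ν δ)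
    (hr : 0 < r) (hτ : 0 ≤ τ) (hτ₂ : 0 ≤ τ₂) (hκ : κ ∈ Set.Icc (1 : ℝ) 2)
    (hH : HessianLipschitzAt J wo τ r) :
    ∃ C μ₁ : ℝ, 0 < C ∧ 0 < μ₁ ∧ μ₁ ≤ 2 * ν / (δ ^ 2 + β ^ 2) ∧
      ∀ {Ω : Type*} [MeasurableSpace Ω] (P : Measure Ω) [IsProbabilityMeasure P]
        (A : AsyncSGD Ω M) (μub μbar σμ : ℝ),
        MemLp A.init 2 P →
        A.NoiseConditions P J wo β σs Rs →
        A.StepConditions P μub μbar σμ →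
        A.CovLipschitzAt P J wo τ₂ κ r →
        muX μbar σμ < 2 * ν / (δ ^ 2 + β ^ 2) →
        -- convergence rate
        ((∀ i, Integrable (fun ω => ‖A.err wo i ω‖ ^ 2) P) ∧
          (∀ i, Integrable (fun ω => J (A.iter i ω) - J wo) P) ∧
          0 ≤ alphaAsyn ν δ β μbar σμ ∧ alphaAsyn ν δ β μbar σμ < 1 ∧
          (∀ i, ∫ ω, ‖A.err wo (i + 1) ω‖ ^ 2 ∂P
            ≤ alphaAsyn ν δ β μbar σμ * ∫ ω, ‖A.err wo i ω‖ ^ 2 ∂P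
              + (μbar ^ 2 + σμ ^ 2) * σs ^ 2) ∧
          |alphaAsyn ν δ β μbar σμ - (1 - 2 * ν * μbar)| ≤ C * muX μbar σμ ^ 2) ∧
        -- mean-square deviation and excess risk
        (muX μbar σμ < μ₁ →
          ((∀ w, hessianMatrix J w = hessianMatrix J wo) ∨
            A.FourthMomentConditions P J wo β₄ σ₄ ρ μbar σμ) →
          |A.msdSup P wo - muX μbar σμ / 2 * ((hessianMatrix J wo)⁻¹ * Rs).trace|
              ≤ C * muX μbar σμ ^ (3 / 2 : ℝ) ∧
          |A.msdInf P wo - muX μbar σμ / 2 * ((hessianMatrix J wo)⁻¹ * Rs).trace|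
              ≤ C * muX μbar σμ ^ (3 / 2 : ℝ) ∧
          |A.erSup P J wo - muX μbar σμ / 4 * Rs.trace| ≤ C * muX μbar σμ ^ (3 / 2 : ℝ) ∧
          |A.erInf P J wo - muX μbar σμ / 4 * Rs.trace| ≤ C * muX μbar σμ ^ (3 / 2 : ℝ)) := by
  have hν := hJ.pos
  have hδ := hJ.pos_upper
  have hgain : 0 < δ ^ 2 + β ^ 2 := by positivity
  set D := deviationConst ν δ β σs τ τ₂ r σ₄ ρ Rs
  set E := excessRiskConst ν δ β σs τ τ₂ r σ₄ ρ Rs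
  set C := max (δ ^ 2 + β ^ 2) (max D E)
  refine ⟨C, stepThreshold ν δ β β₄ ρ, lt_max_of_lt_left hgain,
    stepThreshold_pos hν hδ, stepThreshold_le hν.le, ?_⟩
  intro Ω _ P _ A μub μbar σμ hinit hnoise hstep hcov hμ
  have h : A.StandingConditions P J wo ν δ β σs Rs μub μbar σμ := ⟨hJ, hinit, hnoise, hstep⟩
  refine ⟨⟨h.integrable_norm_err_sq, h.integrable_cost, alphaAsyn_nonneg hν.le hJ.le,
    alphaAsyn_lt_one hδ hstep.mean_pos hμ, h.integral_norm_err_sq_succ_le,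
    (abs_alphaAsyn_sub_le hstep.mean_pos).trans (by gcongr; exact le_max_left _ _)⟩,
    fun hsmall hfourth => ?_⟩
  have hperf : A.PerformanceConditions P J wo ν δ β σs τ τ₂ κ r β₄ σ₄ ρ Rs μub μbar σμ :=
    ⟨h, hr, hτ, hτ₂, hκ, hH, hcov, hfourth, hsmall⟩
  rw [rpow_three_halves_eq_sqrt_pow_three (muX_pos hstep.mean_pos).le]
  obtain ⟨hmsdSup, hmsdInf⟩ :=
    abs_limsup_sub_le_and_abs_liminf_sub_le hperf.eventually_abs_integral_norm_err_sq_sub_le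
  obtain ⟨herSup, herInf⟩ :=
    abs_limsup_sub_le_and_abs_liminf_sub_le hperf.eventually_abs_integral_cost_sub_le
  have hD : D ≤ C := (le_max_left _ _).trans (le_max_right _ _)
  have hE : E ≤ C := (le_max_right _ _).trans (le_max_right _ _)
  exact ⟨hmsdSup.trans (by gcongr), hmsdInf.trans (by gcongr), herSup.trans (by gcongr),
    herInf.trans (by gcongr)⟩
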